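/- **Setting.** Let $\Lambda(X)=\sum_{k\in K}A_kXA_k^\dagger$ be a quantum channel between finite-dimensional systems $A$ and $B$ (finite set $K$, $\sum_kA_k^\dagger A_k=I$) and let $\rho_A$ be a density matrix. Put $\rho_B=\Lambda(\rho_A)$ and $\rho_E=\sum_{k,l}\mathrm{Tr}(A_k\rho_AA_l^\dagger)|k\rangle\langle l|$, where the Kraus operators are chosen such that $\rho_E$ is diagonal in the basis $|k\rangle$. Let $S_X=-\mathrm{Tr}\,\rho_X\log_2\rho_X$ and $I_{coh}=S_B-S_E$. Fix $R<I_{coh}$ and $\delta>0$ with $2\delta<I_{coh}-R$. For $n\in\mathbb N$ and $X\in\{A,B,E\}$ let $\Pi_X$ be the spectral projector of $\rho_X^{\otimes n}$ for its eigenvalues in $[2^{-n(S_X+\delta)},2^{-n(S_X-\delta)}]$, and let $\rho_A^{typ}=\Pi_A\rho_A^{\otimes n}\Pi_A/\mathrm{Tr}(\Pi_A\rho_A^{\otimes n}\Pi_A)$. For a word $k=(k_1,\dots,k_n)$ let $A_k=A_{k_1}\otimes\cdots\otimes A_{k_n}$, and call $k$ typical if $|k\rangle$ lies in the range of $\Pi_E$.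 For a vector $|\alpha\rangle$ of the input space put $$\sigma_B^\alpha=\Lambda^{\otimes n}(|\alpha\rangle\langle\alpha|),\qquad {\sigma_B^\alpha}'=\sum_{k\ \mathrm{typical}}\Pi_BA_k|\alpha\rangle\langle\alpha|A_k^\dagger\Pi_B .$$ For a code $\mathcal C$ of $N$ vectors let $Y_\alpha=G^{-1/2}\Lambda_\alpha G^{-1/2}$ with $\Lambda_\alpha=\Pi_B^\alpha\Pi_B\Pi_B^\alpha$ and $G=\sum_{\beta\in\mathcal C}\Lambda_\beta$, where $\Pi_B^\alpha$ is the projector onto the support of ${\sigma_B^\alpha}'$ and the inverse is taken on the support of $G$. **Proposition (distinguishability).** For every code, $Y_\alpha\ge0$ and $\sum_\alpha Y_\alpha\le I$, so that $\{Y_\alpha\}$ together with the failure outcome $I-\sum_\alpha Y_\alpha$ is a POVM. Moreover there are constants $C$ and $c>0$, depending only on the channel (with its Kraus operators), $\rho_A$, $R$ and $\delta$, such that for all $n$, all integers $1\le N\le2^{nR}$ and every probability distribution of (not necessarily normalized) vectors $|\alpha\rangle$ with $\int|\alpha\rangle\langle\alpha|\,d\alpha=\rho_A^{typ}$, the averages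 $\langle\cdot\rangle_{\mathcal C}$ over codes $\mathcal C$ of $N$ independently drawn codewords satisfy: 1. $\bigl\langle 1-\frac1N\sum_\alpha\mathrm{Tr}({\sigma_B^\alpha}'Y_\alpha)\bigr\rangle_{\mathcal C}\le Ce^{-cn}$; 2. $\bigl\langle 1-\frac1N\sum_\alpha\mathrm{Tr}(\sigma_B^\alpha Y_\alpha)\bigr\rangle_{\mathcal C}\le Ce^{-cn}$; 3. if the codewords are almost surely unit vectors, then $\bigl\langle\,|\log_2N-\chi_B|\,\bigr\rangle_{\mathcal C}\le Ce^{-cn}$, where $\chi_B=S\bigl(\frac1N\sum_\alpha\sigma_B^\alpha\bigr)-\frac1N\sum_\alpha S(\sigma_B^\alpha)$ and $S(\sigma)=-\mathrm{Tr}\,\sigma\log_2\sigma$. In particular, for every $\varepsilon>0$ all three averages are at most $\varepsilon$ for $n$ large enough. -/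

import Mathlib

open MeasureTheory
open scoped Matrix ComplexOrder

noncomputable section

namespace QCoding

/-- Von Neumann entropy in bits, `-Tr ρ log₂ ρ` (with `0 log 0 = 0`). -/
def entropy {a : Type*} [Fintype a] [DecidableEq a] (ρ : Matrix a a ℂ) : ℝ :=
  (Matrix.trace (cfc (fun x : ℝ => Real.negMulLog x / Real.log 2) ρ)).re

/-- A density matrix. -/
def IsState {a : Type*} [Fintype a] (ρ : Matrix a a ℂ) : Prop :=
  ρ.PosSemidef ∧ ρ.trace = 1

/-- Holevo quantity `S(∑ p_i ρ_i) - ∑ p_i S(ρ_i)`. -/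
def holevo {ι a : Type*} [Fintype ι] [Fintype a] [DecidableEq a]
    (p : ι → ℝ) (ρ : ι → Matrix a a ℂ) : ℝ :=
  entropy (∑ i, (p i : ℂ) • ρ i) - ∑ i, p i * entropy (ρ i)

/-- The completely positive map with Kraus operators `A k`. -/
def krausMap {κ a b : Type*} [Fintype κ] [Fintype a] (A : κ → Matrix b a ℂ)
    (X : Matrix a a ℂ) : Matrix b b ℂ :=
  ∑ k, A k * X * (A k)ᴴ

/-- The Kraus operators form a channel (trace preservation). -/
def IsChannel {κ a b : Type*} [Fintype κ] [Fintype b] [DecidableEq a]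
    (A : κ → Matrix b a ℂ) : Prop :=
  ∑ k, (A k)ᴴ * A k = 1

/-- Environment state `ρ_E = ∑_{k,l} Tr(A_k ρ A_l†) |k⟩⟨l|`. -/
def envState {κ a b : Type*} [Fintype a] [Fintype b] (A : κ → Matrix b a ℂ)
    (ρ : Matrix a a ℂ) : Matrix κ κ ℂ :=
  Matrix.of fun k l => Matrix.trace (A k * ρ * (A l)ᴴ)

/-- Coherent information `I_coh = S_B - S_E`. -/
def coherentInfo {κ a b : Type*} [Fintype κ] [DecidableEq κ] [Fintype a] [Fintype b]
    [DecidableEq b] (A : κ → Matrix b a ℂ) (ρ : Matrix a a ℂ) : ℝ :=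
  entropy (krausMap A ρ) - entropy (envState A ρ)

/-- The `n`-fold tensor power `X^{⊗ n}`, with rows and columns indexed by words of length `n`. -/
def tensorPow {a : Type*} (X : Matrix a a ℂ) (n : ℕ) : Matrix (Fin n → a) (Fin n → a) ℂ :=
  Matrix.of fun i j => ∏ t, X (i t) (j t)

/-- The Kraus operators `A_{k₁} ⊗ ⋯ ⊗ A_{kₙ}` of the `n`-fold channel. -/
def krausPow {κ a b : Type*} (A : κ → Matrix b a ℂ) (n : ℕ) (k : Fin n → κ) :
    Matrix (Fin n → b) (Fin n → a) ℂ :=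
  Matrix.of fun i j => ∏ t, A (k t) (i t) (j t)

/-- The eigenvalues that are `δ`-typical for `n` copies of a state with entropy `S`. -/
def typicalWindow (S δ : ℝ) (n : ℕ) : Set ℝ :=
  Set.Icc ((2 : ℝ) ^ (-((n : ℝ) * (S + δ)))) ((2 : ℝ) ^ (-((n : ℝ) * (S - δ))))

/-- Projector onto the `δ`-typical subspace of `ρ^{⊗ n}`: the spectral projector of `ρ^{⊗ n}` for
the typical eigenvalues. -/
def typicalProj {a : Type*} [Fintype a] [DecidableEq a] (ρ : Matrix a a ℂ) (δ : ℝ) (n : ℕ) :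
    Matrix (Fin n → a) (Fin n → a) ℂ :=
  cfc ((typicalWindow (entropy ρ) δ n).indicator (fun _ => (1 : ℝ))) (tensorPow ρ n)

/-- Unnormalized typical version `Π ρ^{⊗ n} Π`. -/
def typicalPart {a : Type*} [Fintype a] [DecidableEq a] (ρ : Matrix a a ℂ) (δ : ℝ) (n : ℕ) :
    Matrix (Fin n → a) (Fin n → a) ℂ :=
  typicalProj ρ δ n * tensorPow ρ n * typicalProj ρ δ n

/-- Normalized typical state `Π ρ^{⊗ n} Π / Tr(Π ρ^{⊗ n} Π)`. -/
def typicalState {a : Type*} [Fintype a] [DecidableEq a] (ρ : Matrix a a ℂ) (δ : ℝ) (n : ℕ) :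
    Matrix (Fin n → a) (Fin n → a) ℂ :=
  (Matrix.trace (typicalPart ρ δ n))⁻¹ • typicalPart ρ δ n

/-- Rank-one operator `|α⟩⟨α|`. -/
def ketBra {m : Type*} (α : m → ℂ) : Matrix m m ℂ :=
  Matrix.vecMulVec α (star α)

/-- The projector onto the support (the span of the eigenvectors with nonzero eigenvalue) of a
Hermitian matrix. -/
def suppProj {m : Type*} [Fintype m] [DecidableEq m] (X : Matrix m m ℂ) : Matrix m m ℂ :=
  cfc (({0}ᶜ : Set ℝ).indicator (fun _ => (1 : ℝ))) X

/-- `X^{-1/2}` of a positive semidefinite matrix, the inverse being taken on the support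
(`0⁻¹ = 0` in Lean). -/
def invSqrt {m : Type*} [Fintype m] [DecidableEq m] (X : Matrix m m ℂ) : Matrix m m ℂ :=
  cfc (fun x : ℝ => (Real.sqrt x)⁻¹) X

section Code

variable {κ a b : Type*} [Fintype κ] [DecidableEq κ] [Fintype a] [DecidableEq a]
  [Fintype b] [DecidableEq b]

/-- The typical words `k`: with `ρ_E` diagonal in the basis `|k⟩`, those whose basis vectors
`|k⟩` span the typical subspace of `ρ_E^{⊗ n}`. -/
def IsTypicalEnv (A : κ → Matrix b a ℂ) (ρ : Matrix a a ℂ) (δ : ℝ) (n : ℕ)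
    (k : Fin n → κ) : Prop :=
  (tensorPow (envState A ρ) n k k).re ∈ typicalWindow (entropy (envState A ρ)) δ n

/-- Bob's actual output `σ_B^α = Λ^{⊗ n}(|α⟩⟨α|)`. -/
def bobOut (A : κ → Matrix b a ℂ) (n : ℕ) (α : (Fin n → a) → ℂ) :
    Matrix (Fin n → b) (Fin n → b) ℂ :=
  krausMap (krausPow A n) (ketBra α)

open Classical in
/-- Bob's projected output `(σ_B^α)' = ∑_k F_k |α⟩⟨α| F_k†`, where `F_k = Π_B A_k` and the sum
runs over the typical `k` only. -/
def bobOutTyp (A : κ → Matrix b a ℂ) (ρ : Matrix a a ℂ) (δ : ℝ) (n : ℕ)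
    (α : (Fin n → a) → ℂ) : Matrix (Fin n → b) (Fin n → b) ℂ :=
  ∑ k : Fin n → κ with IsTypicalEnv A ρ δ n k,
    (typicalProj (krausMap A ρ) δ n * krausPow A n k) * ketBra α *
      (typicalProj (krausMap A ρ) δ n * krausPow A n k)ᴴ

/-- `Λ_α = Π^α Π_B Π^α`, with `Π^α` the projector onto the support of `(σ_B^α)'`. -/
def detector (A : κ → Matrix b a ℂ) (ρ : Matrix a a ℂ) (δ : ℝ) (n : ℕ)
    (α : (Fin n → a) → ℂ) : Matrix (Fin n → b) (Fin n → b) ℂ :=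
  suppProj (bobOutTyp A ρ δ n α) * typicalProj (krausMap A ρ) δ n *
    suppProj (bobOutTyp A ρ δ n α)

/-- The square-root measurement
`Y_i = (∑_j Λ_j)^{-1/2} Λ_i (∑_j Λ_j)^{-1/2}` of a code `c₁, …, c_N`. -/
def sqrtMeas (A : κ → Matrix b a ℂ) (ρ : Matrix a a ℂ) (δ : ℝ) (n : ℕ) {N : ℕ}
    (c : Fin N → (Fin n → a) → ℂ) (i : Fin N) : Matrix (Fin n → b) (Fin n → b) ℂ :=
  invSqrt (∑ j, detector A ρ δ n (c j)) * detector A ρ δ n (c i) *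
    invSqrt (∑ j, detector A ρ δ n (c j))

/-- `1 - (1/N) ∑_α Tr((σ_B^α)' Y_α)`. -/
def errTyp (A : κ → Matrix b a ℂ) (ρ : Matrix a a ℂ) (δ : ℝ) (n : ℕ) {N : ℕ}
    (c : Fin N → (Fin n → a) → ℂ) : ℝ :=
  1 - (1 / (N : ℝ)) *
    ∑ i, (Matrix.trace (bobOutTyp A ρ δ n (c i) * sqrtMeas A ρ δ n c i)).re

/-- `1 - (1/N) ∑_α Tr(σ_B^α Y_α)`. -/
def errActual (A : κ → Matrix b a ℂ) (ρ : Matrix a a ℂ) (δ : ℝ) (n : ℕ) {N : ℕ}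
    (c : Fin N → (Fin n → a) → ℂ) : ℝ :=
  1 - (1 / (N : ℝ)) *
    ∑ i, (Matrix.trace (bobOut A n (c i) * sqrtMeas A ρ δ n c i)).re

/-- `χ_B`, the Holevo quantity of Bob's equiprobable actual outputs. -/
def chiB (A : κ → Matrix b a ℂ) (n : ℕ) {N : ℕ} (c : Fin N → (Fin n → a) → ℂ) : ℝ :=
  holevo (fun _ : Fin N => 1 / (N : ℝ)) (fun i => bobOut A n (c i))

end Code

/-- The ensemble `μ` of (not necessarily normalized) vectors averages to `τ`:
`∫ |α⟩⟨α| dμ(α) = τ`, as an entrywise convergent integral. -/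
def AveragesTo {m : Type*} (μ : Measure (m → ℂ)) (τ : Matrix m m ℂ) : Prop :=
  ∀ i j, Integrable (fun α => ketBra α i j) μ ∧ ∫ α, ketBra α i j ∂μ = τ i j

end QCoding

end

/-! This is random coding with a square-root measurement, followed by a Fano-type estimate for the
Holevo quantity. On average over the ensemble, the projected output `bobOutTyp` keeps all but an
exponentially small part of the weight: atypical input, atypical output and atypical Kraus words
each lose little, by a Chernoff bound (`exists_atypical_bound`). The support of `bobOutTyp` has
dimension at most the number of typical Kraus words, which is at most 2^{n(S_E+δ)}, while the
averaged projected output is bounded, up to the normalization of the typical state, by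
2^{-n(S_B-δ)}. So the output of one codeword triggers the detector of an independent one with
average weight about 2^{-n(I_coh-2δ)} (`integral_detector_overlap_le`). At most 2^{nR} competitors
then contribute an exponentially small total, since R + 2δ < I_coh. The passage from pairwise
overlaps to the measurement is `trace_mul_conj_invSqrt_ge`. The detectors are projectors, and the
tangent bound x^{-1/2} ≥ 3/2 - x/2 on the support of G gives success weight at least Tr σ minus the
overlaps with the other detectors. The measurement acts inside Bob's typical space, so restoring the
discarded parts of the output can only raise the success weight: the second estimate follows from
the first. For the third, let P_i = σ_i/N and Q = ∑ P_i. In nats, log N - χ_B is the sum of Tr P_i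
log Q - Tr P_i log P_i. Each term is nonnegative because P_i ≤ Q. It is bounded above by testing
with the outcome pair (Y_i, 1 - Y_i), because relative entropy decreases under measurement
(`relEnt_measured_le`). Both facts come from the overlaps |⟨u_j, v_k⟩|² of the two eigenbases;
monotonicity uses an integral of quadratic divergences, each with a variational lower bound. The
result is error × log T + N/T, with T = N eⁿ. The extra factor linear in n is paid for by halving
the exponent. -/

noncomputable section

namespace QCoding

set_option linter.unusedSectionVars false

/-! ### Functional calculus in an eigenbasis. -/

section Spectral

variable {m : Type*} [Fintype m] [DecidableEq m]

/-- The matrix `U diag(d) U†` with real diagonal `d`. -/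
def conjDiag (U : Matrix m m ℂ) (d : m → ℝ) : Matrix m m ℂ :=
  U * Matrix.diagonal (fun i => (d i : ℂ)) * Uᴴ

theorem conjDiag_mul {U : Matrix m m ℂ} (hU : Uᴴ * U = 1) (d e : m → ℝ) :
    conjDiag U d * conjDiag U e = conjDiag U (fun i => d i * e i) := by
  have : conjDiag U d * conjDiag U e = U * Matrix.diagonal (fun i => (d i : ℂ)) * (Uᴴ * U) *
      Matrix.diagonal (fun i => (e i : ℂ)) * Uᴴ := by
    simp only [conjDiag, Matrix.mul_assoc]
  rw [this, hU, Matrix.mul_one, Matrix.mul_assoc U, Matrix.diagonal_mul_diagonal]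
  simp [conjDiag]

theorem conjDiag_add (U : Matrix m m ℂ) (d e : m → ℝ) :
    conjDiag U d + conjDiag U e = conjDiag U (fun i => d i + e i) := by
  rw [conjDiag, conjDiag, ← Matrix.add_mul, ← Matrix.mul_add, Matrix.diagonal_add]
  simp [conjDiag]

theorem conjDiag_smul (U : Matrix m m ℂ) (r : ℝ) (d : m → ℝ) :
    r • conjDiag U d = conjDiag U (fun i => r * d i) := by
  have : (fun i => ((r * d i : ℝ) : ℂ)) = r • (fun i => (d i : ℂ)) := by
    ext i; simp
  rw [conjDiag, conjDiag, this, Matrix.diagonal_smul]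
  simp

theorem conjDiag_const {U : Matrix m m ℂ} (hU : U * Uᴴ = 1) (r : ℝ) :
    conjDiag U (fun _ => r) = r • (1 : Matrix m m ℂ) := by
  have : Matrix.diagonal (fun _ : m => (r : ℂ)) = r • (1 : Matrix m m ℂ) := by
    ext i j; by_cases h : i = j <;> simp [Matrix.diagonal, h]
  rw [conjDiag, this]; simp [hU]

theorem conjDiag_isHermitian (U : Matrix m m ℂ) (d : m → ℝ) : (conjDiag U d).IsHermitian := by
  rw [conjDiag, Matrix.IsHermitian, Matrix.conjTranspose_mul, Matrix.conjTranspose_mul,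
    Matrix.conjTranspose_conjTranspose, Matrix.diagonal_conjTranspose, Matrix.mul_assoc]
  congr! 3
  ext i; simp

theorem conjDiag_posSemidef (U : Matrix m m ℂ) {d : m → ℝ} (hd : ∀ i, 0 ≤ d i) :
    (conjDiag U d).PosSemidef := by
  rw [conjDiag]
  refine Matrix.PosSemidef.mul_mul_conjTranspose_same ?_ U
  exact Matrix.PosSemidef.diagonal fun i => by simpa using hd i

theorem conjDiag_trace {U : Matrix m m ℂ} (hU : Uᴴ * U = 1) (d : m → ℝ) :
    (conjDiag U d).trace = ((∑ i, d i : ℝ) : ℂ) := by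
  rw [conjDiag, Matrix.trace_mul_comm, ← Matrix.mul_assoc, hU, Matrix.one_mul,
    Matrix.trace_diagonal]
  simp

theorem aeval_conjDiag {U : Matrix m m ℂ} (hU : Uᴴ * U = 1) (d : m → ℝ) (p : Polynomial ℝ) :
    Polynomial.aeval (conjDiag U d) p = conjDiag U (fun i => p.eval (d i)) := by
  have hU' : U * Uᴴ = 1 := mul_eq_one_comm.mp hU
  induction p using Polynomial.induction_on' with
  | add p q hp hq => rw [map_add, hp, hq, conjDiag_add]; simp
  | monomial k r =>
    have hk : conjDiag U d ^ k = conjDiag U (fun i => d i ^ k) := by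
      induction k with
      | zero => simp [conjDiag_const hU']
      | succ k ih => rw [pow_succ, ih, conjDiag_mul hU]; simp [pow_succ]
    rw [Polynomial.aeval_monomial, hk, ← Algebra.smul_def, conjDiag_smul]
    simp

theorem exists_polynomial_eqOn {s : Set ℝ} (hs : s.Finite) (f : ℝ → ℝ) :
    ∃ p : Polynomial ℝ, ∀ x ∈ s, p.eval x = f x := by
  classical
  refine ⟨Lagrange.interpolate hs.toFinset id f, fun x hx => ?_⟩
  exact Lagrange.eval_interpolate_at_node (v := id) f Function.injective_id.injOn
    (hs.mem_toFinset.mpr hx)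

/-- On a finite set every function agrees with a polynomial, and polynomials act entrywise on the
diagonal. This reduces later statements about `cfc` of a single matrix to scalar ones. -/
theorem cfc_conjDiag {U : Matrix m m ℂ} (hU : Uᴴ * U = 1) (d : m → ℝ) (f : ℝ → ℝ) :
    cfc f (conjDiag U d) = conjDiag U (fun i => f (d i)) := by
  -- Interpolating on the spectrum and on the range of `d` together avoids proving that the two sets
  -- coincide.
  obtain ⟨p, hp⟩ := exists_polynomial_eqOn
    ((Matrix.finite_real_spectrum (A := conjDiag U d)).union (Set.finite_range d)) f
  have h1 : cfc f (conjDiag U d) = cfc (fun x => p.eval x) (conjDiag U d) :=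
    cfc_congr fun x hx => (hp x (Or.inl hx)).symm
  refine h1.trans ((cfc_polynomial p (conjDiag U d) (conjDiag_isHermitian U d)).trans ?_)
  rw [aeval_conjDiag hU]
  congr! 1
  ext i
  exact hp _ (Or.inr ⟨i, rfl⟩)

theorem exists_conjDiag {X : Matrix m m ℂ} (hX : X.IsHermitian) :
    ∃ (U : Matrix m m ℂ) (d : m → ℝ), Uᴴ * U = 1 ∧ U * Uᴴ = 1 ∧ X = conjDiag U d := by
  refine ⟨hX.eigenvectorUnitary, hX.eigenvalues, ?_, ?_, ?_⟩
  · exact Unitary.coe_star_mul_self hX.eigenvectorUnitary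
  · exact Unitary.coe_mul_star_self hX.eigenvectorUnitary
  · conv_lhs => rw [hX.spectral_theorem]
    rfl

theorem conjDiag_nonneg {U : Matrix m m ℂ} (hU : Uᴴ * U = 1) {d : m → ℝ}
    (h : (conjDiag U d).PosSemidef) (i : m) : 0 ≤ d i := by
  have h1 := h.conjTranspose_mul_mul_same U
  have h2 : Uᴴ * conjDiag U d * U = Matrix.diagonal (fun i => (d i : ℂ)) := by
    calc _ = (Uᴴ * U) * Matrix.diagonal (fun i => (d i : ℂ)) * (Uᴴ * U) := by
          simp only [conjDiag, Matrix.mul_assoc]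
      _ = _ := by rw [hU]; simp
  rw [h2] at h1
  have := h1.diag_nonneg (i := i)
  simpa using this

theorem exists_conjDiag_nonneg {X : Matrix m m ℂ} (hX : X.PosSemidef) :
    ∃ (U : Matrix m m ℂ) (d : m → ℝ), Uᴴ * U = 1 ∧ U * Uᴴ = 1 ∧ (∀ i, 0 ≤ d i) ∧
      X = conjDiag U d := by
  obtain ⟨U, d, h1, h2, rfl⟩ := exists_conjDiag hX.1
  exact ⟨U, d, h1, h2, conjDiag_nonneg h1 hX, rfl⟩

theorem cfc_isHermitian (f : ℝ → ℝ) {X : Matrix m m ℂ} (hX : X.IsHermitian) :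
    (cfc f X).IsHermitian := by
  obtain ⟨U, d, h1, h2, rfl⟩ := exists_conjDiag hX
  rw [cfc_conjDiag h1]; exact conjDiag_isHermitian _ _

theorem entropy_conjDiag {U : Matrix m m ℂ} (hU : Uᴴ * U = 1) (d : m → ℝ) :
    entropy (conjDiag U d) = (∑ i, Real.negMulLog (d i)) / Real.log 2 := by
  rw [entropy, cfc_conjDiag hU, conjDiag_trace hU, Complex.ofReal_re, Finset.sum_div]

end Spectral

/-! ### Positivity of traces of products. -/

section Trace

variable {m : Type*} [Fintype m]

theorem trace_mul_re_nonneg {X Y : Matrix m m ℂ} (hX : X.PosSemidef) (hY : Y.PosSemidef) :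
    0 ≤ (X * Y).trace.re := by
  classical
  obtain ⟨U, d, h1, h2, hd, rfl⟩ := exists_conjDiag_nonneg hX
  have : (conjDiag U d * Y).trace =
      (Matrix.diagonal (fun i => (d i : ℂ)) * (Uᴴ * Y * U)).trace := by
    rw [conjDiag, Matrix.mul_assoc, Matrix.mul_assoc, Matrix.trace_mul_comm]
    simp only [Matrix.mul_assoc]
  rw [this, Matrix.trace, Complex.re_sum]
  refine Finset.sum_nonneg fun i _ => ?_
  have h3 := (hY.conjTranspose_mul_mul_same U).diag_nonneg (i := i)
  rw [Matrix.diag_apply, Matrix.diagonal_mul, Complex.re_ofReal_mul]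
  exact mul_nonneg (hd i) (Complex.le_def.mp h3).1

theorem trace_re_nonneg {X : Matrix m m ℂ} (hX : X.PosSemidef) : 0 ≤ X.trace.re :=
  (Complex.le_def.mp hX.trace_nonneg).1

/-- A projector is a positive semidefinite idempotent. -/
theorem posSemidef_of_idem {P : Matrix m m ℂ} (h : P.IsHermitian) (hP : P * P = P) :
    P.PosSemidef := by
  have := Matrix.posSemidef_conjTranspose_mul_self P
  rwa [h.eq, hP] at this

end Trace

/-! ### The square-root measurement of a family of projectors. -/

section SquareRootMeasurement

variable {m : Type*} [Fintype m] [DecidableEq m]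

theorem cfc_indicator_mul_self (s : Set ℝ) {X : Matrix m m ℂ} (hX : X.IsHermitian) :
    cfc (s.indicator fun _ => (1 : ℝ)) X * cfc (s.indicator fun _ => (1 : ℝ)) X =
      cfc (s.indicator fun _ => (1 : ℝ)) X := by
  obtain ⟨U, d, h1, h2, rfl⟩ := exists_conjDiag hX
  rw [cfc_conjDiag h1, conjDiag_mul h1]
  congr! 2 with i
  by_cases h : d i ∈ s <;> simp [h]

theorem suppProj_isHermitian {X : Matrix m m ℂ} (hX : X.IsHermitian) : (suppProj X).IsHermitian :=
  cfc_isHermitian _ hX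

theorem suppProj_mul_self {X : Matrix m m ℂ} (hX : X.IsHermitian) :
    suppProj X * suppProj X = suppProj X :=
  cfc_indicator_mul_self _ hX

theorem suppProj_mul {X : Matrix m m ℂ} (hX : X.IsHermitian) : suppProj X * X = X := by
  obtain ⟨U, d, h1, h2, rfl⟩ := exists_conjDiag hX
  rw [suppProj, cfc_conjDiag h1, conjDiag_mul h1]
  congr! 2 with i
  by_cases h : d i = 0 <;> simp [h]

/-- The support projector factors through the matrix. -/
theorem exists_mul_eq_suppProj {X : Matrix m m ℂ} (hX : X.IsHermitian) :
    ∃ Z, X * Z = suppProj X := by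
  obtain ⟨U, d, h1, h2, rfl⟩ := exists_conjDiag hX
  refine ⟨conjDiag U fun i => (d i)⁻¹, ?_⟩
  rw [suppProj, cfc_conjDiag h1, conjDiag_mul h1]
  congr! 2 with i
  by_cases h : d i = 0 <;> simp [h]

theorem mul_suppProj_of_mul_eq {X Q : Matrix m m ℂ} (hX : X.IsHermitian) (h : Q * X = X) :
    Q * suppProj X = suppProj X := by
  obtain ⟨Z, hZ⟩ := exists_mul_eq_suppProj hX
  rw [← hZ, ← Matrix.mul_assoc, h]

theorem invSqrt_isHermitian {X : Matrix m m ℂ} (hX : X.IsHermitian) : (invSqrt X).IsHermitian :=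
  cfc_isHermitian _ hX

/-- The factorization transfers any left identity of `X` to its inverse square root; it is used to
show that the measurement lives in Bob's typical space. -/
theorem exists_mul_eq_invSqrt {X : Matrix m m ℂ} (hX : X.PosSemidef) :
    ∃ Z, X * Z = invSqrt X := by
  obtain ⟨U, d, h1, h2, hd, rfl⟩ := exists_conjDiag_nonneg hX
  refine ⟨conjDiag U fun i => (d i)⁻¹ * (Real.sqrt (d i))⁻¹, ?_⟩
  rw [invSqrt, cfc_conjDiag h1, conjDiag_mul h1]
  congr! 2 with i
  by_cases h : d i = 0 <;> simp [h]

theorem mul_invSqrt_of_mul_eq {X Q : Matrix m m ℂ} (hX : X.PosSemidef) (h : Q * X = X) :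
    Q * invSqrt X = invSqrt X := by
  obtain ⟨Z, hZ⟩ := exists_mul_eq_invSqrt hX
  rw [← hZ, ← Matrix.mul_assoc, h]

theorem invSqrt_mul_mul_invSqrt {X : Matrix m m ℂ} (hX : X.PosSemidef) :
    invSqrt X * X * invSqrt X = suppProj X := by
  obtain ⟨U, d, h1, h2, hd, rfl⟩ := exists_conjDiag_nonneg hX
  rw [invSqrt, suppProj, cfc_conjDiag h1, cfc_conjDiag h1, conjDiag_mul h1, conjDiag_mul h1]
  congr! 2 with i
  by_cases h : d i = 0
  · simp [h]
  · have hp : 0 < d i := lt_of_le_of_ne (hd i) (Ne.symm h)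
    have hs : 0 < Real.sqrt (d i) := Real.sqrt_pos.mpr hp
    simp only [Set.mem_compl_iff, Set.mem_singleton_iff, h, not_false_eq_true,
      Set.indicator_of_mem]
    field_simp
    exact (Real.sq_sqrt hp.le).symm

/-- The tangent-line bound `x^{-1/2} ≥ 3/2 - x/2` on the support. -/
theorem invSqrt_tangent_posSemidef {X : Matrix m m ℂ} (hX : X.PosSemidef) :
    (invSqrt X + ((-3 / 2 : ℝ) • suppProj X + (1 / 2 : ℝ) • X)).PosSemidef := by
  obtain ⟨U, d, h1, h2, hd, rfl⟩ := exists_conjDiag_nonneg hX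
  rw [invSqrt, suppProj, cfc_conjDiag h1, cfc_conjDiag h1, conjDiag_smul, conjDiag_smul,
    conjDiag_add, conjDiag_add]
  refine conjDiag_posSemidef _ fun i => ?_
  by_cases h : d i = 0
  · simp [h]
  · have hp : 0 < d i := lt_of_le_of_ne (hd i) (Ne.symm h)
    have hs : 0 < Real.sqrt (d i) := Real.sqrt_pos.mpr hp
    simp only [Set.mem_compl_iff, Set.mem_singleton_iff, h, not_false_eq_true,
      Set.indicator_of_mem]
    obtain ⟨s, hs', hds⟩ : ∃ s, 0 < s ∧ d i = s ^ 2 := ⟨_, hs, (Real.sq_sqrt hp.le).symm⟩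
    rw [hds, Real.sqrt_sq hs'.le]
    -- With s = √d the difference has a double zero at s = 1, the point of tangency.
    have : s⁻¹ + (-3 / 2 * 1 + 1 / 2 * s ^ 2) = (s - 1) ^ 2 * (s + 2) / (2 * s) := by
      field_simp; ring
    rw [this]; positivity

theorem one_sub_posSemidef_of_idem {P : Matrix m m ℂ} (h : P.IsHermitian) (hP : P * P = P) :
    (1 - P).PosSemidef := by
  refine posSemidef_of_idem (Matrix.isHermitian_one.sub h) ?_
  rw [Matrix.sub_mul, Matrix.mul_sub, Matrix.mul_sub, hP]; simp

variable {ι : Type*} [Fintype ι] {L : ι → Matrix m m ℂ}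

theorem posSemidef_conj_invSqrt {G X : Matrix m m ℂ} (hG : G.IsHermitian) (hX : X.PosSemidef) :
    (invSqrt G * X * invSqrt G).PosSemidef := by
  have := hX.mul_mul_conjTranspose_same (invSqrt G)
  rwa [(invSqrt_isHermitian hG).eq] at this

theorem sum_posSemidef (hL : ∀ i, (L i).PosSemidef) : (∑ i, L i).PosSemidef :=
  Matrix.posSemidef_sum _ fun i _ => hL i

/-- The elements add up to G^{-1/2} G G^{-1/2}, which is the support projector of G. -/
theorem one_sub_sum_conj_invSqrt_posSemidef (hL : ∀ i, (L i).PosSemidef) :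
    (1 - ∑ i, invSqrt (∑ j, L j) * L i * invSqrt (∑ j, L j)).PosSemidef := by
  have hG := sum_posSemidef hL
  rw [← Finset.sum_mul, ← Finset.mul_sum, invSqrt_mul_mul_invSqrt hG]
  exact one_sub_posSemidef_of_idem (suppProj_isHermitian hG.1) (suppProj_mul_self hG.1)

theorem eq_zero_of_conj_eq {P Q : Matrix m m ℂ} (h : P.IsHermitian) (hP : P * P = P)
    (hQ : Q.IsHermitian) (h0 : (Q * P * Q).trace.re ≤ 0) : P * Q = 0 := by
  have h1 : (P * Q)ᴴ * (P * Q) = Q * P * Q := by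
    rw [Matrix.conjTranspose_mul, h.eq, hQ.eq, Matrix.mul_assoc, ← Matrix.mul_assoc P, hP,
      Matrix.mul_assoc]
  rw [← Matrix.trace_conjTranspose_mul_self_eq_zero_iff, h1]
  have h2 : (Q * P * Q).PosSemidef := h1 ▸ Matrix.posSemidef_conjTranspose_mul_self (P * Q)
  have h3 := Complex.le_def.mp h2.trace_nonneg
  exact Complex.ext (le_antisymm h0 h3.1) h3.2.symm

/-- The complement Q of the support projector kills the whole sum, so the positive operators Q `L j`
Q add up to zero and each of them must vanish. -/
theorem suppProj_sum_mul (hL : ∀ i, (L i).IsHermitian) (hL2 : ∀ i, L i * L i = L i) (i : ι) :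
    suppProj (∑ j, L j) * L i = L i := by
  classical
  have hpos := fun i => posSemidef_of_idem (hL i) (hL2 i)
  have hG := sum_posSemidef hpos
  set G := ∑ j, L j
  set Q := 1 - suppProj G
  have hQ : Q.IsHermitian := Matrix.isHermitian_one.sub (suppProj_isHermitian hG.1)
  have hQG : Q * G = 0 := by simp [Q, Matrix.sub_mul, suppProj_mul hG.1]
  have h0 : (Q * L i * Q).trace.re ≤ 0 := by
    have h1 : 0 ≤ (∑ j ∈ Finset.univ.erase i, Q * L j * Q).trace.re := by
      refine trace_re_nonneg (Matrix.posSemidef_sum _ fun j _ => ?_)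
      have := (hpos j).mul_mul_conjTranspose_same Q
      rwa [hQ.eq] at this
    have h2 : Q * L i * Q + ∑ j ∈ Finset.univ.erase i, Q * L j * Q = 0 := by
      rw [Finset.add_sum_erase _ (fun j => Q * L j * Q) (Finset.mem_univ i), ← Finset.sum_mul,
        ← Finset.mul_sum, hQG, Matrix.zero_mul]
    have h3 := congrArg (fun X => X.trace.re) h2
    simp only [Matrix.trace_add, Complex.add_re, Matrix.trace_zero, Complex.zero_re] at h3
    linarith
  have h1 := eq_zero_of_conj_eq (hL i) (hL2 i) hQ h0
  have h2 := congrArg Matrix.conjTranspose h1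
  rw [Matrix.conjTranspose_mul, (hL i).eq, hQ.eq, Matrix.conjTranspose_zero] at h2
  have h3 : Q * L i = L i - suppProj G * L i := by simp [Q, Matrix.sub_mul]
  rw [h3] at h2
  exact (sub_eq_zero.mp h2).symm

/-- Success probability of the square-root measurement of a family of projectors `L i` on a
positive operator supported on `L i`. -/
theorem trace_mul_conj_invSqrt_ge (hL : ∀ i, (L i).IsHermitian) (hL2 : ∀ i, L i * L i = L i)
    (i : ι) {σ : Matrix m m ℂ} (hσ : σ.PosSemidef) (hLσ : L i * σ = σ) :
    2 * σ.trace.re - (σ * ∑ j, L j).trace.re ≤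
      (σ * (invSqrt (∑ j, L j) * L i * invSqrt (∑ j, L j))).trace.re := by
  have hpos := fun i => posSemidef_of_idem (hL i) (hL2 i)
  have hG := sum_posSemidef hpos
  have hs := suppProj_sum_mul hL hL2 i
  set G := ∑ j, L j
  set W := invSqrt G
  have hW : W.IsHermitian := invSqrt_isHermitian hG.1
  have hσL : σ * L i = σ := by
    have := congrArg Matrix.conjTranspose hLσ
    rwa [Matrix.conjTranspose_mul, hσ.1.eq, (hL i).eq] at this
  have hσG : σ * suppProj G = σ := by
    have h1 : suppProj G * σ = σ := by rw [← hLσ, ← Matrix.mul_assoc, hs]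
    have := congrArg Matrix.conjTranspose h1
    rwa [Matrix.conjTranspose_mul, hσ.1.eq, (suppProj_isHermitian hG.1).eq] at this
  -- Since `L i` fixes σ, expanding this square gives Tr σWLW ≥ 2 Tr σW - Tr σ. The tangent bound
  -- below gives 2 Tr σW ≥ 3 Tr σ - Tr σG.
  have h1 : 0 ≤ (σ * ((1 - W) * L i * (1 - W))).trace.re := by
    refine trace_mul_re_nonneg hσ ?_
    have := (hpos i).mul_mul_conjTranspose_same (1 - W)
    rwa [(Matrix.isHermitian_one.sub hW).eq] at this
  have h2 : 0 ≤ (σ * (W + ((-3 / 2 : ℝ) • suppProj G + (1 / 2 : ℝ) • G))).trace.re :=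
    trace_mul_re_nonneg hσ (invSqrt_tangent_posSemidef hG)
  have h3 : (σ * (W * L i)).trace = (σ * W).trace := by
    rw [← Matrix.mul_assoc, Matrix.trace_mul_comm, ← Matrix.mul_assoc, hLσ]
  have h4 : σ * ((1 - W) * L i * (1 - W)) = σ * L i - (σ * L i) * W - σ * (W * L i) +
      σ * (W * L i * W) := by
    noncomm_ring
  rw [h4, hσL] at h1
  rw [Matrix.mul_add, Matrix.mul_add, Matrix.mul_smul, Matrix.mul_smul, hσG] at h2
  simp only [Matrix.trace_add, Matrix.trace_sub, h3, Complex.add_re, Complex.sub_re,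
    Matrix.trace_smul, Complex.smul_re, smul_eq_mul] at h1 h2
  linarith

end SquareRootMeasurement

/-! ### Scalar relative entropy as an integral of quadratic divergences. -/

section ScalarRelativeEntropy

/-- The summand `p log (p / q) - p + q` of the relative entropy. -/
def relEntFun (p q : ℝ) : ℝ := p * Real.log p - p * Real.log q - p + q

theorem tendsto_relEnt_primitive {p q : ℝ} (hp : 0 ≤ p) :
    Filter.Tendsto (fun s : ℝ => p * (Real.log (q + s * p) - Real.log (1 + s)) - (q - p) / (1 + s))
      Filter.atTop (nhds (p * Real.log p)) := by
  have h1 : Filter.Tendsto (fun s : ℝ => 1 + s) Filter.atTop Filter.atTop :=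
    Filter.tendsto_atTop_add_const_left _ _ Filter.tendsto_id
  have h2 : Filter.Tendsto (fun s : ℝ => (q - p) / (1 + s)) Filter.atTop (nhds 0) :=
    h1.const_div_atTop _
  rcases hp.eq_or_lt with rfl | hp
  · simpa using h2.neg
  have h3 : Filter.Tendsto (fun s : ℝ => p + (q - p) / (1 + s)) Filter.atTop (nhds p) := by
    simpa using h2.const_add p
  have h4 := ((Real.continuousAt_log hp.ne').tendsto.comp h3).const_mul p
  have h5 := h4.sub h2
  rw [sub_zero] at h5
  refine h5.congr' ?_
  filter_upwards [Filter.eventually_gt_atTop (0 : ℝ), Filter.eventually_gt_atTop (-q / p)]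
    with s hs hs'
  have hs'' : 0 < q + s * p := by
    rw [div_lt_iff₀ hp] at hs'; linarith
  have h1s : (1 + s) ≠ 0 := by positivity
  rw [← Real.log_div hs''.ne' h1s, Function.comp_apply]
  congr! 3
  field_simp; ring

/-- Quadratic divergences, unlike logarithms, have an elementary variational bound that survives the
passage to matrices; this formula carries that bound over to relative entropy. The integrand has an
explicit primitive, whose limit at infinity is p log p and whose value at 0 supplies the remaining
terms. -/
theorem integral_relEntFun {p q : ℝ} (hp : 0 ≤ p) (hq : 0 ≤ q) (hpq : q = 0 → p = 0) :
    IntegrableOn (fun s : ℝ => (p - q) ^ 2 / (q + s * p) / (1 + s) ^ 2) (Set.Ioi 0) ∧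
      ∫ s in Set.Ioi (0 : ℝ), (p - q) ^ 2 / (q + s * p) / (1 + s) ^ 2 = relEntFun p q := by
  rcases hq.eq_or_lt with rfl | hq
  · obtain rfl := hpq rfl
    simp [relEntFun]
  have hderiv : ∀ s ∈ Set.Ici (0 : ℝ),
      HasDerivAt (fun s : ℝ => p * (Real.log (q + s * p) - Real.log (1 + s)) - (q - p) / (1 + s))
        ((p - q) ^ 2 / (q + s * p) / (1 + s) ^ 2) s := by
    intro s hs
    have hs : 0 ≤ s := hs
    have h1 : 0 < q + s * p := by positivity
    have h2 : 0 < 1 + s := by positivity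
    have d1 : HasDerivAt (fun s : ℝ => q + s * p) p s := by
      simpa using ((hasDerivAt_id s).mul_const p).const_add q
    have d2 : HasDerivAt (fun s : ℝ => 1 + s) 1 s := (hasDerivAt_id s).const_add 1
    have d3 := (((d1.log h1.ne').sub (d2.log h2.ne')).const_mul p).sub
      ((hasDerivAt_const s (q - p)).div d2 h2.ne')
    refine d3.congr_deriv ?_
    field_simp; ring
  have hnn : ∀ s ∈ Set.Ioi (0 : ℝ), 0 ≤ (p - q) ^ 2 / (q + s * p) / (1 + s) ^ 2 := by
    intro s hs
    have hs : 0 < s := hs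
    positivity
  refine ⟨integrableOn_Ioi_deriv_of_nonneg' hderiv hnn (tendsto_relEnt_primitive hp), ?_⟩
  rw [integral_Ioi_of_hasDerivAt_of_nonneg' hderiv hnn (tendsto_relEnt_primitive hp), relEntFun]
  simp; ring

/-- This is log x ≤ x - 1 at x = tq/p. The free parameter t allows different linear bounds for the
two measurement outcomes. -/
theorem le_mul_log_sub {p q t : ℝ} (hp : 0 ≤ p) (hq : 0 ≤ q) (hpq : q = 0 → p = 0) (ht : 0 < t) :
    p + p * Real.log t - t * q ≤ p * Real.log p - p * Real.log q := by
  rcases hp.eq_or_lt with rfl | hp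
  · simp; positivity
  have hq : 0 < q := lt_of_le_of_ne hq fun h => hp.ne' (hpq h.symm)
  have h1 := Real.log_le_sub_one_of_pos (show 0 < t * q / p by positivity)
  rw [Real.log_div (by positivity) hp.ne', Real.log_mul ht.ne' hq.ne'] at h1
  have h2 := mul_le_mul_of_nonneg_left h1 hp.le
  have h3 : p * (t * q / p - 1) = t * q - p := by field_simp
  rw [h3] at h2
  linarith

end ScalarRelativeEntropy

/-! ### Reduction of two non-commuting matrices to the overlaps of their eigenbases. -/

section MatrixRelativeEntropy

variable {m : Type*} [Fintype m] [DecidableEq m]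

/-- The doubly stochastic overlap `|⟨u_j, v_k⟩|²` of two bases. -/
def overlap (U V : Matrix m m ℂ) (j k : m) : ℝ := Complex.normSq ((Uᴴ * V) j k)

theorem overlap_nonneg (U V : Matrix m m ℂ) (j k : m) : 0 ≤ overlap U V j k :=
  Complex.normSq_nonneg _

theorem overlap_comm (U V : Matrix m m ℂ) (j k : m) : overlap U V j k = overlap V U k j := by
  have : (Uᴴ * V) j k = star ((Vᴴ * U) k j) := by
    rw [← Matrix.conjTranspose_apply, Matrix.conjTranspose_mul, Matrix.conjTranspose_conjTranspose]
  rw [overlap, overlap, this]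
  exact Complex.normSq_conj _

theorem mul_diagonal_mul_conjTranspose_apply (M : Matrix m m ℂ) (e : m → ℝ) (j : m) :
    (M * Matrix.diagonal (fun i => (e i : ℂ)) * Mᴴ) j j =
      ((∑ k, Complex.normSq (M j k) * e k : ℝ) : ℂ) := by
  rw [Matrix.mul_apply, Complex.ofReal_sum]
  refine Finset.sum_congr rfl fun k _ => ?_
  rw [Matrix.mul_diagonal, Matrix.conjTranspose_apply, Complex.ofReal_mul,
    Complex.normSq_eq_conj_mul_self]
  simp only [RCLike.star_def]; ring

theorem conj_conjDiag_apply (U V : Matrix m m ℂ) (e : m → ℝ) (j : m) :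
    (Uᴴ * conjDiag V e * U) j j = ((∑ k, overlap U V j k * e k : ℝ) : ℂ) := by
  have : Uᴴ * conjDiag V e * U =
      (Uᴴ * V) * Matrix.diagonal (fun i => (e i : ℂ)) * (Uᴴ * V)ᴴ := by
    rw [Matrix.conjTranspose_mul, Matrix.conjTranspose_conjTranspose, conjDiag]
    simp only [Matrix.mul_assoc]
  rw [this, mul_diagonal_mul_conjTranspose_apply]
  rfl

theorem trace_conjDiag_mul (U X : Matrix m m ℂ) (p : m → ℝ) :
    (conjDiag U p * X).trace = ∑ j, (p j : ℂ) * (Uᴴ * X * U) j j := by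
  have : (conjDiag U p * X).trace =
      (Matrix.diagonal (fun i => (p i : ℂ)) * (Uᴴ * X * U)).trace := by
    rw [conjDiag, Matrix.mul_assoc, Matrix.mul_assoc, Matrix.trace_mul_comm]
    simp only [Matrix.mul_assoc]
  rw [this, Matrix.trace]
  simp [Matrix.diagonal_mul]

theorem trace_conjDiag_mul_conjDiag (U V : Matrix m m ℂ) (p e : m → ℝ) :
    (conjDiag U p * conjDiag V e).trace.re = ∑ j, ∑ k, overlap U V j k * (p j * e k) := by
  rw [trace_conjDiag_mul]
  simp only [conj_conjDiag_apply, ← Complex.ofReal_mul, ← Complex.ofReal_sum, Complex.ofReal_re,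
    Finset.mul_sum]
  refine Finset.sum_congr rfl fun j _ => Finset.sum_congr rfl fun k _ => by ring

theorem overlap_sum_right {U V : Matrix m m ℂ} (hU : Uᴴ * U = 1) (hV : V * Vᴴ = 1) (j : m) :
    ∑ k, overlap U V j k = 1 := by
  have h := conj_conjDiag_apply U V (fun _ => 1) j
  rw [conjDiag_const hV, one_smul, Matrix.mul_one, hU, Matrix.one_apply_eq] at h
  simpa using (Complex.ofReal_injective h).symm

theorem overlap_sum_left {U V : Matrix m m ℂ} (hU : U * Uᴴ = 1) (hV : Vᴴ * V = 1) (k : m) :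
    ∑ j, overlap U V j k = 1 := by
  simp only [overlap_comm U V]
  exact overlap_sum_right hV hU k

/-- The k-th diagonal entry in the basis V bounds a sum of nonnegative terms, of which one is kept.
It shows that q k = 0 forces p j = 0 wherever the overlap is nonzero, so the scalar formulas apply
there. -/
theorem overlap_mul_le {U V : Matrix m m ℂ} (hV : Vᴴ * V = 1) {p q : m → ℝ} (hp : ∀ j, 0 ≤ p j)
    (h : (conjDiag V q - conjDiag U p).PosSemidef) (j k : m) : overlap U V j k * p j ≤ q k := by
  have h1 := (Complex.le_def.mp ((h.conjTranspose_mul_mul_same V).diag_nonneg (i := k))).1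
  have h2 : Vᴴ * conjDiag V q * V = Matrix.diagonal (fun i => (q i : ℂ)) := by
    calc _ = (Vᴴ * V) * Matrix.diagonal (fun i => (q i : ℂ)) * (Vᴴ * V) := by
          simp only [conjDiag, Matrix.mul_assoc]
      _ = _ := by rw [hV]; simp
  rw [Matrix.mul_sub, Matrix.sub_mul, h2, Matrix.sub_apply, conj_conjDiag_apply,
    Matrix.diagonal_apply_eq, ← Complex.ofReal_sub, Complex.ofReal_re, Complex.zero_re] at h1
  have h3 := Finset.single_le_sum (f := fun j => overlap V U k j * p j)
    (fun j _ => mul_nonneg (overlap_nonneg _ _ _ _) (hp j)) (Finset.mem_univ j)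
  rw [overlap_comm]
  linarith

theorem trace_conjTranspose_mul (A B : Matrix m m ℂ) :
    (Aᴴ * B).trace.re = ∑ j, ∑ k, (star (A j k) * B j k).re := by
  rw [Matrix.trace, Complex.re_sum, Finset.sum_comm]
  refine Finset.sum_congr rfl fun j _ => ?_
  rw [Matrix.diag_apply, Matrix.mul_apply, Complex.re_sum]
  rfl

/-- Completing the square in x; the condition for r = 0 removes the linear term there. -/
theorem two_mul_re_sub_le {x z : ℂ} {p q r : ℝ} (hr : 0 ≤ r) (h0 : r = 0 → p = q) :
    2 * (star x * (((p - q : ℝ) : ℂ) * z)).re - r * Complex.normSq x ≤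
      Complex.normSq z * ((p - q) ^ 2 / r) := by
  rcases hr.eq_or_lt with rfl | hr
  · simp [h0 rfl]
  rw [← mul_div_assoc, le_div_iff₀ hr]
  simp only [Complex.normSq_apply, RCLike.star_def, Complex.mul_re, Complex.conj_re,
    Complex.conj_im, Complex.mul_im, Complex.ofReal_re, Complex.ofReal_im]
  nlinarith [sq_nonneg (r * x.re - (p - q) * z.re), sq_nonneg (r * x.im - (p - q) * z.im)]

/-- Variational lower bound for the quadratic divergences that generate the relative entropy. -/
theorem quadratic_variational {U V : Matrix m m ℂ} (hU : U * Uᴴ = 1) (hV : V * Vᴴ = 1)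
    {p q : m → ℝ} (hp : ∀ j, 0 ≤ p j) (hq : ∀ k, 0 ≤ q k) {X : Matrix m m ℂ}
    (hX : X.IsHermitian) {s : ℝ} (hs : 0 < s) :
    2 * ((conjDiag U p * X).trace.re - (conjDiag V q * X).trace.re) -
        s * (conjDiag U p * (X * X)).trace.re - (conjDiag V q * (X * X)).trace.re ≤
      ∑ j, ∑ k, overlap U V j k * ((p j - q k) ^ 2 / (q k + s * p j)) := by
  -- Read in the two eigenbases, all four traces become entrywise sums over (j, k) with Z as the
  -- unknown, so the claim splits into a completed square for each entry, with weight q k + s p j.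
  set Z := Uᴴ * X * V with hZ
  set M := Uᴴ * V with hM
  have hZH : Zᴴ = Vᴴ * X * U := by
    rw [hZ, Matrix.conjTranspose_mul, Matrix.conjTranspose_mul, Matrix.conjTranspose_conjTranspose,
      hX.eq, Matrix.mul_assoc]
  set D := Matrix.diagonal (fun i => (p i : ℂ))
  set E := Matrix.diagonal (fun i => (q i : ℂ))
  have e1 : (conjDiag U p * X).trace = (Zᴴ * (D * M)).trace := by
    calc (conjDiag U p * X).trace = (conjDiag U p * (V * Vᴴ) * X).trace := by
          rw [hV, Matrix.mul_one]
      _ = (U * D * Uᴴ * V * (Vᴴ * X)).trace := by simp only [conjDiag, Matrix.mul_assoc, D]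
      _ = (Vᴴ * X * (U * D * Uᴴ * V)).trace := Matrix.trace_mul_comm _ _
      _ = _ := by rw [hZH, hM]; simp only [Matrix.mul_assoc]
  have e2 : (conjDiag V q * X).trace = (Zᴴ * (M * E)).trace := by
    calc (conjDiag V q * X).trace = (V * (E * Vᴴ * X)).trace := by
          simp only [conjDiag, Matrix.mul_assoc, E]
      _ = (E * Vᴴ * X * V).trace := Matrix.trace_mul_comm _ _
      _ = (E * (Vᴴ * X * V)).trace := by simp only [Matrix.mul_assoc]
      _ = (Vᴴ * X * V * E).trace := Matrix.trace_mul_comm _ _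
      _ = (Vᴴ * X * (U * Uᴴ) * V * E).trace := by rw [hU, Matrix.mul_one]
      _ = _ := by rw [hZH, hM]; simp only [Matrix.mul_assoc]
  have e3 : (conjDiag U p * (X * X)).trace = (Zᴴ * (D * Z)).trace := by
    calc (conjDiag U p * (X * X)).trace = (conjDiag U p * X * (V * Vᴴ) * X).trace := by
          rw [hV, Matrix.mul_one]; simp only [Matrix.mul_assoc]
      _ = (U * D * Uᴴ * X * V * (Vᴴ * X)).trace := by simp only [conjDiag, Matrix.mul_assoc, D]
      _ = (Vᴴ * X * (U * D * Uᴴ * X * V)).trace := Matrix.trace_mul_comm _ _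
      _ = _ := by rw [hZH, hZ]; simp only [Matrix.mul_assoc]
  have e4 : (conjDiag V q * (X * X)).trace = (Zᴴ * (Z * E)).trace := by
    calc (conjDiag V q * (X * X)).trace = (V * E * (Vᴴ * X * X)).trace := by
          simp only [conjDiag, Matrix.mul_assoc, E]
      _ = (Vᴴ * X * X * (V * E)).trace := Matrix.trace_mul_comm _ _
      _ = (Vᴴ * X * (U * Uᴴ) * X * V * E).trace := by
          rw [hU, Matrix.mul_one]; simp only [Matrix.mul_assoc]
      _ = _ := by rw [hZH, hZ]; simp only [Matrix.mul_assoc]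
  rw [e1, e2, e3, e4]
  simp only [trace_conjTranspose_mul, Finset.mul_sum, ← Finset.sum_sub_distrib]
  refine Finset.sum_le_sum fun j _ => Finset.sum_le_sum fun k _ => ?_
  have h1 := two_mul_re_sub_le (x := Z j k) (z := M j k) (p := p j) (q := q k)
    (r := q k + s * p j) (by have := hp j; have := hq k; positivity) (by
      intro h
      have h1 := hq k
      have h2 := mul_nonneg hs.le (hp j)
      have h3 : s * p j = 0 := by linarith
      have h4 : p j = 0 := by simpa [hs.ne'] using h3
      rw [h4] at h ⊢; linarith)
  refine le_trans (le_of_eq ?_) h1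
  simp only [D, E, Matrix.diagonal_mul, Matrix.mul_diagonal, Complex.normSq_apply, RCLike.star_def,
    Complex.mul_re, Complex.conj_re, Complex.conj_im, Complex.mul_im, Complex.ofReal_re,
    Complex.ofReal_im]
  ring

end MatrixRelativeEntropy

/-! ### Relative entropy under a two-outcome measurement, and under P ≤ Q. -/

section MeasuredRelativeEntropy

variable {m : Type*} [Fintype m] [DecidableEq m]

theorem sub_mul_self_posSemidef {Y : Matrix m m ℂ} (hY : Y.PosSemidef)
    (hY1 : (1 - Y).PosSemidef) : (Y - Y * Y).PosSemidef := by
  have h1 := hY.mul_mul_conjTranspose_same (1 - Y)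
  have h2 := hY1.mul_mul_conjTranspose_same Y
  rw [hY1.1.eq] at h1
  rw [hY.1.eq] at h2
  have h3 : Y - Y * Y = (1 - Y) * Y * (1 - Y) + Y * (1 - Y) * Y := by noncomm_ring
  rw [h3]; exact h1.add h2

theorem sq_div_eq_variational (p q r : ℝ) :
    2 * ((p - q) / r) * (p - q) - ((p - q) / r) ^ 2 * r = (p - q) ^ 2 / r := by
  by_cases h : r = 0
  · simp [h]
  · field_simp; ring

/-- Quadratic divergences decrease under a two-outcome measurement. -/
theorem quadratic_measured_le {U V : Matrix m m ℂ} (hU : U * Uᴴ = 1) (hV : V * Vᴴ = 1)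
    {p q : m → ℝ} (hp : ∀ j, 0 ≤ p j) (hq : ∀ k, 0 ≤ q k) {Y : Matrix m m ℂ}
    (hY : Y.PosSemidef) (hY1 : (1 - Y).PosSemidef) {s : ℝ} (hs : 0 < s)
    {p₁ q₁ p₂ q₂ : ℝ} (hp₁ : (conjDiag U p * Y).trace.re = p₁)
    (hq₁ : (conjDiag V q * Y).trace.re = q₁) (hp₂ : (conjDiag U p * (1 - Y)).trace.re = p₂)
    (hq₂ : (conjDiag V q * (1 - Y)).trace.re = q₂) :
    (p₁ - q₁) ^ 2 / (q₁ + s * p₁) + (p₂ - q₂) ^ 2 / (q₂ + s * p₂) ≤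
      ∑ j, ∑ k, overlap U V j k * ((p j - q k) ^ 2 / (q k + s * p j)) := by
  have hP := conjDiag_posSemidef U hp
  have hQ := conjDiag_posSemidef V hq
  -- These are the optimizers of the two scalar problems. The test matrix built from them satisfies
  -- X² ≤ x₁² Y + x₂² (1 - Y), the defect being (x₁ - x₂)² (Y - Y²) ≥ 0. A vanishing denominator is
  -- harmless: division by zero makes both optimizer and quotient 0.
  set x₁ := (p₁ - q₁) / (q₁ + s * p₁)
  set x₂ := (p₂ - q₂) / (q₂ + s * p₂)
  set X : Matrix m m ℂ := (x₁ : ℂ) • Y + (x₂ : ℂ) • (1 - Y) with hXdef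
  have hreal : ∀ x : ℝ, IsSelfAdjoint (x : ℂ) := fun x => Complex.conj_ofReal x
  have hX : X.IsHermitian := (hY.1.smul (hreal _)).add (hY1.1.smul (hreal _))
  have hvar := quadratic_variational hU hV hp hq hX hs
  have hXX : X * X = ((x₁ ^ 2 : ℝ) : ℂ) • Y + ((x₂ ^ 2 : ℝ) : ℂ) • (1 - Y)
      - (((x₁ - x₂) ^ 2 : ℝ) : ℂ) • (Y - Y * Y) := by
    rw [hXdef]
    simp only [Matrix.add_mul, Matrix.mul_add, Matrix.smul_mul, Matrix.mul_smul, Matrix.sub_mul,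
      Matrix.mul_sub, Matrix.one_mul, Matrix.mul_one]
    push_cast
    module
  have hlin : ∀ Z : Matrix m m ℂ, (Z * X).trace.re =
      x₁ * (Z * Y).trace.re + x₂ * (Z * (1 - Y)).trace.re := by
    intro Z
    rw [hXdef, Matrix.mul_add, Matrix.mul_smul, Matrix.mul_smul, Matrix.trace_add,
      Matrix.trace_smul, Matrix.trace_smul, Complex.add_re, smul_eq_mul, smul_eq_mul,
      Complex.re_ofReal_mul, Complex.re_ofReal_mul]
  have hsq : ∀ Z : Matrix m m ℂ, Z.PosSemidef → (Z * (X * X)).trace.re ≤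
      x₁ ^ 2 * (Z * Y).trace.re + x₂ ^ 2 * (Z * (1 - Y)).trace.re := by
    intro Z hZ
    have h1 := trace_mul_re_nonneg hZ (sub_mul_self_posSemidef hY hY1)
    rw [hXX, Matrix.mul_sub, Matrix.mul_add, Matrix.mul_smul, Matrix.mul_smul, Matrix.mul_smul,
      Matrix.trace_sub, Matrix.trace_add, Matrix.trace_smul, Matrix.trace_smul, Matrix.trace_smul,
      Complex.sub_re, Complex.add_re, smul_eq_mul, smul_eq_mul, smul_eq_mul,
      Complex.re_ofReal_mul, Complex.re_ofReal_mul, Complex.re_ofReal_mul]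
    have h2 := mul_nonneg (sq_nonneg (x₁ - x₂)) h1
    linarith
  have hsP := mul_le_mul_of_nonneg_left (hsq _ hP) hs.le
  have hsQ := hsq _ hQ
  rw [hlin, hlin, hp₁, hq₁, hp₂, hq₂] at hvar
  rw [hp₁, hp₂] at hsP
  rw [hq₁, hq₂] at hsQ
  have e1 := sq_div_eq_variational p₁ q₁ (q₁ + s * p₁)
  have e2 := sq_div_eq_variational p₂ q₂ (q₂ + s * p₂)
  change 2 * x₁ * (p₁ - q₁) - x₁ ^ 2 * (q₁ + s * p₁) = _ at e1
  change 2 * x₂ * (p₂ - q₂) - x₂ ^ 2 * (q₂ + s * p₂) = _ at e2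
  linarith

/-- The relative entropy decreases under a two-outcome measurement. -/
theorem relEnt_measured_le {U V : Matrix m m ℂ} (hU : U * Uᴴ = 1) (hV : V * Vᴴ = 1)
    (hV' : Vᴴ * V = 1)
    {p q : m → ℝ} (hp : ∀ j, 0 ≤ p j) (hq : ∀ k, 0 ≤ q k)
    (hPQ : (conjDiag V q - conjDiag U p).PosSemidef) {Y : Matrix m m ℂ}
    (hY : Y.PosSemidef) (hY1 : (1 - Y).PosSemidef) :
    relEntFun (conjDiag U p * Y).trace.re (conjDiag V q * Y).trace.re +
        relEntFun (conjDiag U p * (1 - Y)).trace.re (conjDiag V q * (1 - Y)).trace.re ≤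
      ∑ j, ∑ k, overlap U V j k * relEntFun (p j) (q k) := by
  have hP := conjDiag_posSemidef U hp
  have hQ := conjDiag_posSemidef V hq
  have hzero : ∀ Z : Matrix m m ℂ, Z.PosSemidef → (conjDiag V q * Z).trace.re = 0 →
      (conjDiag U p * Z).trace.re = 0 := by
    intro Z hZ h0
    have h1 := trace_mul_re_nonneg hPQ hZ
    rw [Matrix.sub_mul, Matrix.trace_sub, Complex.sub_re] at h1
    exact le_antisymm (by linarith) (trace_mul_re_nonneg hP hZ)
  obtain ⟨i1, e1⟩ := integral_relEntFun (trace_mul_re_nonneg hP hY) (trace_mul_re_nonneg hQ hY)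
    (hzero Y hY)
  obtain ⟨i2, e2⟩ := integral_relEntFun (trace_mul_re_nonneg hP hY1)
    (trace_mul_re_nonneg hQ hY1) (hzero _ hY1)
  -- The integral formula needs q k = 0 → p j = 0. Pairs violating it have zero overlap and drop
  -- out.
  have hjk : ∀ j k, IntegrableOn (fun s : ℝ => overlap U V j k *
        ((p j - q k) ^ 2 / (q k + s * p j) / (1 + s) ^ 2)) (Set.Ioi 0) ∧
      ∫ s in Set.Ioi (0 : ℝ), overlap U V j k *
        ((p j - q k) ^ 2 / (q k + s * p j) / (1 + s) ^ 2) =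
          overlap U V j k * relEntFun (p j) (q k) := by
    intro j k
    by_cases ho : overlap U V j k = 0
    · simp [ho]
    have h0 : q k = 0 → p j = 0 := by
      intro h
      have h1 := overlap_mul_le hV' hp hPQ j k
      have h2 := mul_nonneg (overlap_nonneg U V j k) (hp j)
      have h3 : overlap U V j k * p j = 0 := by linarith
      simpa [ho] using h3
    obtain ⟨i, e⟩ := integral_relEntFun (hp j) (hq k) h0
    refine ⟨i.const_mul _, ?_⟩
    rw [integral_const_mul, e]
  rw [← e1, ← e2, ← integral_add i1 i2]
  simp only [← (hjk _ _).2]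
  simp_rw [← integral_finsetSum Finset.univ (fun k _ => (hjk _ k).1)]
  rw [← integral_finsetSum Finset.univ
    (fun j _ => integrable_finsetSum Finset.univ (fun k _ => (hjk j k).1))]
  refine setIntegral_mono_on (i1.add i2)
    (integrable_finsetSum _ fun j _ => integrable_finsetSum _ fun k _ => (hjk j k).1)
    measurableSet_Ioi fun s hs => ?_
  have hs : 0 < s := hs
  have h := quadratic_measured_le hU hV hp hq hY hY1 hs rfl rfl rfl rfl
  have h2 := div_le_div_of_nonneg_right h (show 0 ≤ (1 + s) ^ 2 by positivity)
  rw [add_div] at h2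
  refine h2.trans (le_of_eq ?_)
  simp only [Finset.sum_div, mul_div_assoc]

/-- The overlaps are doubly stochastic, so terms depending on one index alone collapse to traces;
only p log q keeps the coupling of the two bases. -/
theorem sum_overlap_relEntFun {U V : Matrix m m ℂ} (hU : U * Uᴴ = 1) (hV : V * Vᴴ = 1)
    (hU' : Uᴴ * U = 1) (hV' : Vᴴ * V = 1) (p q : m → ℝ) :
    ∑ j, ∑ k, overlap U V j k * relEntFun (p j) (q k) =
      -(entropy (conjDiag U p) * Real.log 2) -
        (conjDiag U p * cfc Real.log (conjDiag V q)).trace.re -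
        (conjDiag U p).trace.re + (conjDiag V q).trace.re := by
  have hlog : Real.log 2 ≠ 0 := (Real.log_pos one_lt_two).ne'
  rw [cfc_conjDiag hV', trace_conjDiag_mul_conjDiag, entropy_conjDiag hU', conjDiag_trace hU',
    conjDiag_trace hV', Complex.ofReal_re, Complex.ofReal_re, div_mul_cancel₀ _ hlog]
  have hj : ∀ f : m → ℝ, ∑ j, ∑ k, overlap U V j k * f j = ∑ j, f j := by
    intro f
    refine Finset.sum_congr rfl fun j _ => ?_
    rw [← Finset.sum_mul, overlap_sum_right hU' hV, one_mul]
  have hk : ∀ f : m → ℝ, ∑ j, ∑ k, overlap U V j k * f k = ∑ k, f k := by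
    intro f
    rw [Finset.sum_comm]
    refine Finset.sum_congr rfl fun k _ => ?_
    rw [← Finset.sum_mul, overlap_sum_left hU hV', one_mul]
  have h1 := hj fun j => p j * Real.log (p j)
  have h2 := hj p
  have h3 := hk q
  have h4 : ∑ i, Real.negMulLog (p i) = -∑ i, p i * Real.log (p i) := by
    simp [Real.negMulLog]
  rw [h4, neg_neg, ← h1, ← h2, ← h3]
  simp only [← Finset.sum_sub_distrib, ← Finset.sum_add_distrib, relEntFun]
  refine Finset.sum_congr rfl fun j _ => Finset.sum_congr rfl fun k _ => by ring

/-- Upper bound for minus the relative entropy through a two-outcome measurement. -/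
theorem trace_mul_log_add_entropy_le {P Q Y : Matrix m m ℂ} (hP : P.PosSemidef)
    (hQ : Q.PosSemidef) (hPQ : (Q - P).PosSemidef) (hY : Y.PosSemidef)
    (hY1 : (1 - Y).PosSemidef) {T : ℝ} (hT : 0 < T) :
    (P * cfc Real.log Q).trace.re + entropy P * Real.log 2 ≤
      (Q * Y).trace.re - (P * Y).trace.re + (P * (1 - Y)).trace.re * (Real.log T - 1) +
        (Q * (1 - Y)).trace.re / T := by
  have hzero : ∀ Z : Matrix m m ℂ, Z.PosSemidef → (Q * Z).trace.re = 0 →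
      (P * Z).trace.re = 0 := by
    intro Z hZ h0
    have h1 := trace_mul_re_nonneg hPQ hZ
    rw [Matrix.sub_mul, Matrix.trace_sub, Complex.sub_re] at h1
    exact le_antisymm (by linarith) (trace_mul_re_nonneg hP hZ)
  -- For the outcome `Y` the linear bound is taken at t = 1, and for the failure outcome at t = 1/T,
  -- so that only the small failure weight is multiplied by log T.
  have hb1 := le_mul_log_sub (trace_mul_re_nonneg hP hY) (trace_mul_re_nonneg hQ hY)
    (hzero Y hY) one_pos
  have hb2 := le_mul_log_sub (trace_mul_re_nonneg hP hY1) (trace_mul_re_nonneg hQ hY1)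
    (hzero _ hY1) (inv_pos.mpr hT)
  obtain ⟨U, p, hU', hU, hp, rfl⟩ := exists_conjDiag_nonneg hP
  obtain ⟨V, q, hV', hV, hq, rfl⟩ := exists_conjDiag_nonneg hQ
  have h := relEnt_measured_le hU hV hV' hp hq hPQ hY hY1
  rw [sum_overlap_relEntFun hU hV hU' hV', relEntFun, relEntFun] at h
  have htr : ∀ Z : Matrix m m ℂ, Z.trace.re = (Z * Y).trace.re + (Z * (1 - Y)).trace.re := by
    intro Z
    rw [← Complex.add_re, ← Matrix.trace_add, ← Matrix.mul_add]; simp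
  rw [htr (conjDiag U p), htr (conjDiag V q)] at h
  rw [Real.log_one] at hb1
  rw [Real.log_inv] at hb2
  rw [div_eq_inv_mul]
  linarith

/-- Conjugating P ≤ Q with the inverse B of Q on its support gives BPB ≤ B. In the j-th eigenvector
of P this reads p_j r² ≤ r, where r is the sum in question. -/
theorem mul_sum_overlap_div_le {U V : Matrix m m ℂ}
    (hV' : Vᴴ * V = 1) {p q : m → ℝ} (hp : ∀ j, 0 ≤ p j) (hq : ∀ k, 0 ≤ q k)
    (hPQ : (conjDiag V q - conjDiag U p).PosSemidef) (j : m) :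
    p j * ∑ k, overlap U V j k * (q k)⁻¹ ≤ 1 := by
  set r := ∑ k, overlap U V j k * (q k)⁻¹ with hr
  set B := conjDiag V fun k => (q k)⁻¹
  have hB : B.IsHermitian := conjDiag_isHermitian _ _
  set C := Uᴴ * B * U with hC
  have hCH : Cᴴ = C := by
    rw [hC, Matrix.conjTranspose_mul, Matrix.conjTranspose_mul, Matrix.conjTranspose_conjTranspose,
      hB.eq, Matrix.mul_assoc]
  have hCj : C j j = (r : ℂ) := conj_conjDiag_apply U V _ j
  have h1 := hPQ.mul_mul_conjTranspose_same B
  rw [hB.eq] at h1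
  have h2 := (Complex.le_def.mp ((h1.conjTranspose_mul_mul_same U).diag_nonneg (i := j))).1
  have h3 : B * conjDiag V q * B = B := by
    rw [conjDiag_mul hV', conjDiag_mul hV']
    congr! 2 with k
    by_cases h : q k = 0 <;> simp [h]
  have h4 : Uᴴ * (B * (conjDiag V q - conjDiag U p) * B) * U =
      C - C * Matrix.diagonal (fun i => (p i : ℂ)) * Cᴴ := by
    rw [Matrix.mul_sub, Matrix.sub_mul, h3, Matrix.mul_sub, Matrix.sub_mul, hCH, hC, conjDiag]
    simp only [Matrix.mul_assoc]
  rw [h4, Matrix.sub_apply, mul_diagonal_mul_conjTranspose_apply, hCj, ← Complex.ofReal_sub,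
    Complex.ofReal_re, Complex.zero_re] at h2
  have h5 := Finset.single_le_sum (f := fun k => Complex.normSq (C j k) * p k)
    (fun k _ => mul_nonneg (Complex.normSq_nonneg _) (hp k)) (Finset.mem_univ j)
  simp only [hCj, Complex.normSq_ofReal] at h5
  have hr0 : 0 ≤ r := Finset.sum_nonneg fun k _ =>
    mul_nonneg (overlap_nonneg _ _ _ _) (inv_nonneg.mpr (hq k))
  rcases hr0.eq_or_lt with h0 | h0
  · rw [← h0]; simp
  · have h6 : r * (p j * r) ≤ r * 1 := by linarith
    exact le_of_mul_le_mul_left h6 h0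

/-- If `P ≤ Q`, then `Tr P log Q ≥ Tr P log P`. -/
theorem trace_mul_log_add_entropy_nonneg {P Q : Matrix m m ℂ} (hP : P.PosSemidef)
    (hQ : Q.PosSemidef) (hPQ : (Q - P).PosSemidef) :
    0 ≤ (P * cfc Real.log Q).trace.re + entropy P * Real.log 2 := by
  obtain ⟨U, p, hU', hU, hp, rfl⟩ := exists_conjDiag_nonneg hP
  obtain ⟨V, q, hV', hV, hq, rfl⟩ := exists_conjDiag_nonneg hQ
  have hsum := sum_overlap_relEntFun hU hV hU' hV' p q
  -- The bound log(p/q) ≤ p/q - 1 replaces the logarithm by p²/q, whose overlap sum is at most Tr P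
  -- by the preceding lemma. No operator monotonicity of the logarithm is needed.
  have h1 : ∑ j, ∑ k, overlap U V j k * relEntFun (p j) (q k) ≤
      ∑ j, ∑ k, overlap U V j k * (q k - 2 * p j + p j * (p j * (q k)⁻¹)) := by
    refine Finset.sum_le_sum fun j _ => Finset.sum_le_sum fun k _ => ?_
    by_cases ho : overlap U V j k * p j = 0
    · rcases mul_eq_zero.mp ho with h | h
      · simp [h]
      · simp [h, relEntFun]
    have hpj : 0 < p j := lt_of_le_of_ne (hp j) fun h => ho (by rw [← h, mul_zero])
    have hqk : 0 < q k := by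
      refine lt_of_lt_of_le ?_ (overlap_mul_le hV' hp hPQ j k)
      exact lt_of_le_of_ne (mul_nonneg (overlap_nonneg _ _ _ _) (hp j)) (Ne.symm ho)
    refine mul_le_mul_of_nonneg_left ?_ (overlap_nonneg _ _ _ _)
    have h2 := Real.log_le_sub_one_of_pos (div_pos hpj hqk)
    rw [Real.log_div hpj.ne' hqk.ne'] at h2
    have h3 := mul_le_mul_of_nonneg_left h2 hpj.le
    rw [div_eq_mul_inv] at h3
    rw [relEntFun]
    linarith
  have h2 : ∑ j, ∑ k, overlap U V j k * (q k - 2 * p j + p j * (p j * (q k)⁻¹)) ≤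
      ∑ k, q k - ∑ j, p j := by
    have e1 : ∑ j, ∑ k, overlap U V j k * q k = ∑ k, q k := by
      rw [Finset.sum_comm]
      refine Finset.sum_congr rfl fun k _ => ?_
      rw [← Finset.sum_mul, overlap_sum_left hU hV', one_mul]
    have e2 : ∑ j, ∑ k, overlap U V j k * p j = ∑ j, p j := by
      refine Finset.sum_congr rfl fun j _ => ?_
      rw [← Finset.sum_mul, overlap_sum_right hU' hV, one_mul]
    have e3 : ∑ j, ∑ k, overlap U V j k * (p j * (p j * (q k)⁻¹)) ≤ ∑ j, p j := by
      refine Finset.sum_le_sum fun j _ => ?_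
      have h3 := mul_le_mul_of_nonneg_left (mul_sum_overlap_div_le hV' hp hq hPQ j) (hp j)
      rw [mul_one] at h3
      refine le_trans (le_of_eq ?_) h3
      rw [Finset.mul_sum, Finset.mul_sum]
      exact Finset.sum_congr rfl fun k _ => by ring
    have e4 : ∑ j, ∑ k, overlap U V j k * (q k - 2 * p j + p j * (p j * (q k)⁻¹)) =
        ∑ j, ∑ k, overlap U V j k * q k - 2 * ∑ j, ∑ k, overlap U V j k * p j +
          ∑ j, ∑ k, overlap U V j k * (p j * (p j * (q k)⁻¹)) := by
      simp only [Finset.mul_sum, ← Finset.sum_sub_distrib, ← Finset.sum_add_distrib]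
      exact Finset.sum_congr rfl fun j _ => Finset.sum_congr rfl fun k _ => by ring
    rw [e4, e1, e2]; linarith
  rw [hsum, conjDiag_trace hU', conjDiag_trace hV', Complex.ofReal_re, Complex.ofReal_re] at h1
  linarith

end MeasuredRelativeEntropy

/-! ### The Holevo quantity of distinguishable equiprobable states. -/

section Holevo

variable {m : Type*} [Fintype m] [DecidableEq m]

theorem entropy_smul (c : ℝ) {σ : Matrix m m ℂ} (hσ : σ.PosSemidef) :
    entropy ((c : ℂ) • σ) * Real.log 2 =
      c * (entropy σ * Real.log 2) - c * Real.log c * σ.trace.re := by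
  have hlog : Real.log 2 ≠ 0 := (Real.log_pos one_lt_two).ne'
  obtain ⟨U, d, h1, h2, hd, rfl⟩ := exists_conjDiag_nonneg hσ
  have : (c : ℂ) • conjDiag U d = conjDiag U fun i => c * d i := by
    rw [← conjDiag_smul]; rfl
  rw [this, entropy_conjDiag h1, entropy_conjDiag h1, conjDiag_trace h1, Complex.ofReal_re,
    div_mul_cancel₀ _ hlog, div_mul_cancel₀ _ hlog, Finset.mul_sum, Finset.mul_sum,
    ← Finset.sum_sub_distrib]
  refine Finset.sum_congr rfl fun i _ => ?_
  rw [Real.negMulLog_mul, Real.negMulLog, Real.negMulLog]; ring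

theorem trace_mul_cfc_log {Q : Matrix m m ℂ} (hQ : Q.IsHermitian) :
    (Q * cfc Real.log Q).trace.re = -(entropy Q * Real.log 2) := by
  have hlog : Real.log 2 ≠ 0 := (Real.log_pos one_lt_two).ne'
  obtain ⟨U, d, h1, h2, rfl⟩ := exists_conjDiag hQ
  rw [cfc_conjDiag h1, conjDiag_mul h1, conjDiag_trace h1, entropy_conjDiag h1,
    div_mul_cancel₀ _ hlog, Complex.ofReal_re]
  simp [Real.negMulLog]

/-- The Holevo quantity of equiprobable states is at most `log₂ N`, and close to it if the states
can be distinguished with small error probability. -/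
theorem holevo_uniform_bounds {N : ℕ} (hN : 0 < N) {σ Y : Fin N → Matrix m m ℂ}
    (hσ : ∀ i, IsState (σ i)) (hY : ∀ i, (Y i).PosSemidef) (hY1 : (1 - ∑ i, Y i).PosSemidef)
    {T : ℝ} (hT : 0 < T) :
    0 ≤ Real.logb 2 N - holevo (fun _ : Fin N => 1 / (N : ℝ)) σ ∧
      (Real.logb 2 N - holevo (fun _ : Fin N => 1 / (N : ℝ)) σ) * Real.log 2 ≤
        (1 - (1 / (N : ℝ)) * ∑ i, (σ i * Y i).trace.re) * Real.log T + N / T := by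
  have hlog : 0 < Real.log 2 := Real.log_pos one_lt_two
  have hN' : (0 : ℝ) < N := by exact_mod_cast hN
  set c : ℝ := 1 / (N : ℝ) with hc
  have hc0 : 0 < c := by positivity
  have hNc : (N : ℝ) * c = 1 := by rw [hc]; field_simp
  set P : Fin N → Matrix m m ℂ := fun i => (c : ℂ) • σ i with hPdef
  set Q := ∑ i, P i with hQdef
  have hP : ∀ i, (P i).PosSemidef := fun i =>
    (hσ i).1.smul (Complex.zero_le_real.mpr hc0.le)
  have hQ : Q.PosSemidef := sum_posSemidef hP
  have hPQ : ∀ i, (Q - P i).PosSemidef := by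
    intro i
    have : Q - P i = ∑ j ∈ Finset.univ.erase i, P j := by
      rw [hQdef, ← Finset.add_sum_erase _ P (Finset.mem_univ i), add_sub_cancel_left]
    rw [this]; exact Matrix.posSemidef_sum _ fun j _ => hP j
  have hYi : ∀ i, (1 - Y i).PosSemidef := by
    intro i
    have : 1 - Y i = (1 - ∑ j, Y j) + ∑ j ∈ Finset.univ.erase i, Y j := by
      rw [← Finset.add_sum_erase _ Y (Finset.mem_univ i)]; abel
    rw [this]; exact hY1.add (Matrix.posSemidef_sum _ fun j _ => hY j)
  have hPtr : ∀ i, (P i).trace.re = c := by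
    intro i; simp [hPdef, (hσ i).2]
  have hQtr : Q.trace.re = 1 := by
    rw [hQdef, Matrix.trace_sum, Complex.re_sum, Finset.sum_congr rfl fun i _ => hPtr i]
    simp [hNc]
  -- Summing Tr P_i log Q over i gives Tr Q log Q, and the normalization 1/N inside the entropies of
  -- the P_i produces log N.
  have hkey : ∑ i, ((P i * cfc Real.log Q).trace.re + entropy (P i) * Real.log 2) =
      (Real.logb 2 N - holevo (fun _ : Fin N => c) σ) * Real.log 2 := by
    rw [Finset.sum_add_distrib, ← Complex.re_sum, ← Matrix.trace_sum, ← Finset.sum_mul, ← hQdef,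
      trace_mul_cfc_log hQ.1, holevo]
    have h1 : ∀ i, entropy (P i) * Real.log 2 =
        c * (entropy (σ i) * Real.log 2) - c * Real.log c := by
      intro i
      rw [hPdef]
      simp only
      rw [entropy_smul c (hσ i).1, (hσ i).2]; simp
    simp only [h1, Finset.sum_sub_distrib, Finset.sum_const, Finset.card_univ, Fintype.card_fin,
      nsmul_eq_mul]
    have h2 : Real.log c = -Real.log N := by rw [hc, one_div, Real.log_inv]
    have h3 : Real.logb 2 N * Real.log 2 = Real.log N := div_mul_cancel₀ _ hlog.ne'
    have h4 : (N : ℝ) * (c * Real.log c) = -Real.log N := by rw [← mul_assoc, hNc, h2, one_mul]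
    have h5 : ∑ i, c * (entropy (σ i) * Real.log 2) = (∑ i, c * entropy (σ i)) * Real.log 2 := by
      rw [Finset.sum_mul]; exact Finset.sum_congr rfl fun i _ => by ring
    rw [h4, h5]
    have h6 : (∑ i, (c : ℂ) • σ i) = Q := rfl
    rw [h6, sub_mul, sub_mul, h3]
    ring
  constructor
  · have h1 : 0 ≤ (Real.logb 2 N - holevo (fun _ : Fin N => c) σ) * Real.log 2 := by
      rw [← hkey]
      exact Finset.sum_nonneg fun i _ =>
        trace_mul_log_add_entropy_nonneg (hP i) hQ (hPQ i)
    exact nonneg_of_mul_nonneg_left h1 hlog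
  · rw [← hkey]
    refine (Finset.sum_le_sum fun i _ =>
      trace_mul_log_add_entropy_le (hP i) hQ (hPQ i) (hY i) (hYi i) hT).trans ?_
    have hPY : ∑ i, (P i * Y i).trace.re = c * ∑ i, (σ i * Y i).trace.re := by
      rw [Finset.mul_sum]
      exact Finset.sum_congr rfl fun i _ => by simp [hPdef]
    have hPY' : ∑ i, (P i * (1 - Y i)).trace.re = 1 - c * ∑ i, (σ i * Y i).trace.re := by
      rw [← hPY]
      simp only [Matrix.mul_sub, Matrix.mul_one, Matrix.trace_sub, Complex.sub_re, hPtr,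
        Finset.sum_sub_distrib]
      simp [hNc]
    -- The terms Tr Q Y_i - Tr P_i Y_i sum to at most the average error, which cancels the -1 in
    -- error × (log T - 1).
    have hQY : ∑ i, (Q * Y i).trace.re ≤ 1 := by
      have h1 := trace_mul_re_nonneg hQ hY1
      rw [Matrix.mul_sub, Matrix.mul_one, Matrix.trace_sub, Complex.sub_re, hQtr, Finset.mul_sum,
        Matrix.trace_sum, Complex.re_sum] at h1
      linarith
    have hQY' : ∑ i, (Q * (1 - Y i)).trace.re ≤ N := by
      refine (Finset.sum_le_card_nsmul _ _ 1 fun i _ => ?_).trans (le_of_eq (by simp))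
      have h1 := trace_mul_re_nonneg hQ (hY i)
      rw [Matrix.mul_sub, Matrix.mul_one, Matrix.trace_sub, Complex.sub_re, hQtr]
      linarith
    have hQT := div_le_div_of_nonneg_right hQY' hT.le
    rw [Finset.sum_add_distrib, Finset.sum_add_distrib, Finset.sum_sub_distrib, ← Finset.sum_mul,
      ← Finset.sum_div, hPY, hPY']
    linarith

end Holevo

/-! ### Tensor powers of states and channels. -/

section TensorProduct

variable {a b c κ : Type*} {n : ℕ}

/-- The tensor product of `n` matrices, with rows and columns indexed by words. -/
def tensorProd (M : Fin n → Matrix b a ℂ) : Matrix (Fin n → b) (Fin n → a) ℂ :=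
  Matrix.of fun i j => ∏ t, M t (i t) (j t)

theorem tensorPow_eq (X : Matrix a a ℂ) (n : ℕ) : tensorPow X n = tensorProd fun _ => X := rfl

theorem krausPow_eq (A : κ → Matrix b a ℂ) (n : ℕ) (k : Fin n → κ) :
    krausPow A n k = tensorProd fun t => A (k t) := rfl

theorem tensorProd_mul [Fintype b] (M : Fin n → Matrix c b ℂ) (L : Fin n → Matrix b a ℂ) :
    tensorProd M * tensorProd L = tensorProd fun t => M t * L t := by
  ext i j
  simp only [tensorProd, Matrix.mul_apply, Matrix.of_apply]
  rw [Finset.prod_univ_sum, Fintype.piFinset_univ]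
  simp only [Finset.prod_mul_distrib]

theorem tensorProd_conjTranspose (M : Fin n → Matrix b a ℂ) :
    (tensorProd M)ᴴ = tensorProd fun t => (M t)ᴴ := by
  ext i j
  simp [tensorProd, Matrix.conjTranspose_apply]

theorem tensorProd_diagonal [DecidableEq a] (e : Fin n → a → ℂ) :
    (tensorProd fun t => Matrix.diagonal (e t)) = Matrix.diagonal fun w => ∏ t, e t (w t) := by
  ext i j
  by_cases h : i = j
  · subst h; simp [tensorProd]
  · obtain ⟨t, ht⟩ := Function.ne_iff.mp h
    rw [Matrix.diagonal_apply_ne _ h, tensorProd, Matrix.of_apply]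
    exact Finset.prod_eq_zero (Finset.mem_univ t) (Matrix.diagonal_apply_ne _ ht)

theorem tensorProd_one [DecidableEq a] :
    (tensorProd fun _ : Fin n => (1 : Matrix a a ℂ)) = 1 := by
  have := tensorProd_diagonal (n := n) (fun _ (_ : a) => (1 : ℂ))
  simpa using this

theorem tensorProd_trace [Fintype a] (M : Fin n → Matrix a a ℂ) :
    (tensorProd M).trace = ∏ t, (M t).trace := by
  simp only [Matrix.trace, Finset.prod_univ_sum, Fintype.piFinset_univ]
  rfl

theorem sum_tensorProd [Fintype κ] (M : κ → Matrix b a ℂ) :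
    ∑ k : Fin n → κ, tensorProd (fun t => M (k t)) = tensorProd fun _ => ∑ k, M k := by
  ext i j
  simp only [tensorProd, Matrix.sum_apply, Matrix.of_apply]
  rw [Finset.prod_univ_sum, Fintype.piFinset_univ]

theorem tensorPow_conjTranspose_mul_self [Fintype a] [DecidableEq a] {U : Matrix a a ℂ}
    (hU : Uᴴ * U = 1) (n : ℕ) : (tensorPow U n)ᴴ * tensorPow U n = 1 := by
  rw [tensorPow_eq, tensorProd_conjTranspose, tensorProd_mul]
  simp only [hU]
  exact tensorProd_one

theorem tensorPow_conjDiag [Fintype a] [DecidableEq a] (U : Matrix a a ℂ) (d : a → ℝ) (n : ℕ) :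
    tensorPow (conjDiag U d) n = conjDiag (tensorPow U n) fun w => ∏ t, d (w t) := by
  have h := tensorProd_diagonal (n := n) fun _ i => (d i : ℂ)
  simp only [conjDiag, Complex.ofReal_prod]
  rw [← h, tensorPow_eq U, tensorProd_conjTranspose, tensorProd_mul, tensorProd_mul]
  rfl

theorem krausMap_krausPow_tensorPow [Fintype κ] [Fintype a] (A : κ → Matrix b a ℂ)
    (X : Matrix a a ℂ) (n : ℕ) :
    krausMap (krausPow A n) (tensorPow X n) = tensorPow (krausMap A X) n := by
  simp only [krausMap, krausPow_eq, tensorPow_eq, tensorProd_conjTranspose, tensorProd_mul]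
  exact sum_tensorProd fun k => A k * X * (A k)ᴴ

theorem isChannel_krausPow [Fintype κ] [Fintype b] [DecidableEq a] {A : κ → Matrix b a ℂ}
    (hA : IsChannel A) (n : ℕ) : IsChannel (krausPow A n) := by
  rw [IsChannel] at *
  simp only [krausPow_eq, tensorProd_conjTranspose, tensorProd_mul]
  rw [sum_tensorProd fun k => (A k)ᴴ * A k, hA]
  exact tensorProd_one

theorem trace_krausPow [Fintype a] [Fintype b] (A : κ → Matrix b a ℂ) (ρ : Matrix a a ℂ) (n : ℕ)
    (k : Fin n → κ) :
    (krausPow A n k * tensorPow ρ n * (krausPow A n k)ᴴ).trace =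
      tensorPow (envState A ρ) n k k := by
  simp only [krausPow_eq, tensorPow_eq, tensorProd_conjTranspose, tensorProd_mul,
    tensorProd_trace]
  rfl

end TensorProduct

/-! ### Traces and positivity under channels. -/

section Channel

variable {a b κ : Type*} [Fintype κ] [Fintype a] [Fintype b]

theorem trace_krausMap [DecidableEq a] {A : κ → Matrix b a ℂ} (hA : IsChannel A)
    (X : Matrix a a ℂ) : (krausMap A X).trace = X.trace := by
  rw [krausMap, Matrix.trace_sum]
  have : ∀ k, (A k * X * (A k)ᴴ).trace = ((A k)ᴴ * A k * X).trace := by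
    intro k
    rw [Matrix.trace_mul_comm, Matrix.mul_assoc]
  simp only [this]
  rw [← Matrix.trace_sum, ← Finset.sum_mul, hA, Matrix.one_mul]

theorem krausMap_posSemidef (A : κ → Matrix b a ℂ) {X : Matrix a a ℂ} (hX : X.PosSemidef) :
    (krausMap A X).PosSemidef :=
  Matrix.posSemidef_sum _ fun k _ => hX.mul_mul_conjTranspose_same (A k)

theorem isState_krausMap [DecidableEq a] {A : κ → Matrix b a ℂ} (hA : IsChannel A)
    {ρ : Matrix a a ℂ} (hρ : IsState ρ) : IsState (krausMap A ρ) :=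
  ⟨krausMap_posSemidef A hρ.1, by rw [trace_krausMap hA, hρ.2]⟩

theorem trace_envState (A : κ → Matrix b a ℂ) (ρ : Matrix a a ℂ) :
    (envState A ρ).trace = (krausMap A ρ).trace := by
  rw [krausMap, Matrix.trace_sum]; rfl

end Channel

/-! ### Exponential concentration on typical subspaces. -/

section Typicality

variable {a : Type*} [Fintype a]

/-- The moment generating function equals 1 at s = 0 and has negative derivative there, so it drops
below 1 to the right of 0. -/
theorem exists_sum_mul_exp_lt_one {d x : a → ℝ} (hd : ∑ i, d i = 1) (hx : ∑ i, d i * x i < 0) :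
    ∃ s : ℝ, 0 < s ∧ ∑ i, d i * Real.exp (s * x i) < 1 := by
  have h : HasDerivAt (fun s : ℝ => ∑ i, d i * Real.exp (s * x i)) (∑ i, d i * x i) 0 := by
    refine HasDerivAt.fun_sum fun i _ => ?_
    have h1 : HasDerivAt (fun s : ℝ => s * x i) (x i) 0 := by
      simpa using (hasDerivAt_id (0 : ℝ)).mul_const (x i)
    simpa using h1.exp.const_mul (d i)
  have h2 := h.tendsto_slope_zero_right.eventually_lt_const hx
  obtain ⟨s, hs, hs0⟩ := (h2.and self_mem_nhdsWithin).exists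
  have hs0 : 0 < s := hs0
  refine ⟨s, hs0, ?_⟩
  simp only [zero_add, zero_mul, Real.exp_zero, mul_one, hd, smul_eq_mul] at hs
  have h3 : s * (s⁻¹ * (∑ i, d i * Real.exp (s * x i) - 1)) < 0 := mul_neg_of_pos_of_neg hs0 hs
  rw [mul_inv_cancel_left₀ hs0.ne'] at h3
  linarith

theorem sum_prod_word (f : a → ℝ) (n : ℕ) : ∑ w : Fin n → a, ∏ t, f (w t) = (∑ i, f i) ^ n := by
  have := Finset.prod_univ_sum (fun _ : Fin n => (Finset.univ : Finset a)) fun _ i => f i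
  rw [Fintype.piFinset_univ] at this
  rw [← this]; simp

theorem pow_le_exp {r : ℝ} (hr : 0 ≤ r) (hr1 : r < 1) :
    ∃ c : ℝ, 0 < c ∧ ∀ n : ℕ, r ^ n ≤ Real.exp (-c * n) := by
  refine ⟨1 - r, by linarith, fun n => ?_⟩
  have h : r ≤ Real.exp (-(1 - r)) := by
    have := Real.add_one_le_exp (-(1 - r)); linarith
  calc r ^ n ≤ Real.exp (-(1 - r)) ^ n := pow_le_pow_left₀ hr h n
    _ = _ := by rw [← Real.exp_nat_mul]; ring_nf

/-- The probability that the empirical mean of `x` is nonnegative decays exponentially if the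
expectation of `x` is negative. -/
theorem exists_exp_bound_of_mean_neg {d x : a → ℝ} (hd0 : ∀ i, 0 ≤ d i) (hd : ∑ i, d i = 1)
    (hx : ∑ i, d i * x i < 0) :
    ∃ c : ℝ, 0 < c ∧ ∀ (n : ℕ) (F : Finset (Fin n → a)),
      (∀ w ∈ F, ∏ t, d (w t) = 0 ∨ 0 ≤ ∑ t, x (w t)) →
        ∑ w ∈ F, ∏ t, d (w t) ≤ Real.exp (-c * n) := by
  obtain ⟨s, hs, hs1⟩ := exists_sum_mul_exp_lt_one hd hx
  have hnn : ∀ i, 0 ≤ d i * Real.exp (s * x i) := fun i =>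
    mul_nonneg (hd0 i) (Real.exp_pos _).le
  obtain ⟨c, hc, hcn⟩ := pow_le_exp (Finset.sum_nonneg fun i _ => hnn i) hs1
  refine ⟨c, hc, fun n F hF => le_trans ?_ (hcn n)⟩
  -- Chernoff: on the event each weight is at most its exponentially tilted version, and the tilted
  -- weights of all words sum to an n-th power.
  rw [← sum_prod_word]
  refine (Finset.sum_le_sum fun w hw => ?_).trans
    (Finset.sum_le_univ_sum_of_nonneg fun w => Finset.prod_nonneg fun t _ => hnn (w t))
  rw [Finset.prod_mul_distrib, ← Real.exp_sum, ← Finset.mul_sum]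
  rcases hF w hw with h | h
  · rw [h, zero_mul]
  · have h1 : 1 ≤ Real.exp (s * ∑ t, x (w t)) := Real.one_le_exp (mul_nonneg hs.le h)
    exact le_mul_of_one_le_right (Finset.prod_nonneg fun t _ => hd0 (w t)) h1

theorem sum_log_word {d : a → ℝ} {n : ℕ} {w : Fin n → a} (hw : ∏ t, d (w t) ≠ 0) (r : ℝ) :
    ∑ t, (Real.log (d (w t)) + r) = Real.log (∏ t, d (w t)) + n * r := by
  rw [Finset.sum_add_distrib, Real.log_prod fun t _ =>
    Finset.prod_ne_zero_iff.mp hw t (Finset.mem_univ t)]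
  simp

/-- Atypical words have exponentially small probability. -/
theorem exists_atypical_bound {d : a → ℝ} (hd0 : ∀ i, 0 ≤ d i) (hd : ∑ i, d i = 1) {δ S : ℝ}
    (hδ : 0 < δ) (hS : S = (∑ i, Real.negMulLog (d i)) / Real.log 2) :
    ∃ c : ℝ, 0 < c ∧ ∀ (n : ℕ) (F : Finset (Fin n → a)),
      (∀ w ∈ F, ∏ t, d (w t) ∉ typicalWindow S δ n) →
        ∑ w ∈ F, ∏ t, d (w t) ≤ 2 * Real.exp (-c * n) := by
  classical
  have hlog : 0 < Real.log 2 := Real.log_pos one_lt_two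
  have hSl : ∑ i, d i * Real.log (d i) = -(S * Real.log 2) := by
    rw [hS, div_mul_cancel₀ _ hlog.ne']; simp [Real.negMulLog]
  have hmean : ∀ r : ℝ, ∑ i, d i * (Real.log (d i) + r) = r - S * Real.log 2 := by
    intro r
    simp only [mul_add, Finset.sum_add_distrib, ← Finset.sum_mul, hd, hSl]; ring
  obtain ⟨c₁, hc₁, h₁⟩ := exists_exp_bound_of_mean_neg hd0 hd
    (x := fun i => Real.log (d i) + (S - δ) * Real.log 2) (by
      rw [hmean]; nlinarith)
  obtain ⟨c₂, hc₂, h₂⟩ := exists_exp_bound_of_mean_neg hd0 hd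
    (x := fun i => -(Real.log (d i) + (S + δ) * Real.log 2)) (by
      simp only [mul_neg, Finset.sum_neg_distrib]
      rw [hmean]; nlinarith)
  refine ⟨min c₁ c₂, lt_min hc₁ hc₂, fun n F hF => ?_⟩
  have hpow : ∀ r : ℝ, Real.log ((2 : ℝ) ^ (-((n : ℝ) * r))) = -(n * (r * Real.log 2)) := by
    intro r; rw [Real.log_rpow two_pos]; ring
  have hb₁ := h₁ n (F.filter fun w => (2 : ℝ) ^ (-((n : ℝ) * (S - δ))) < ∏ t, d (w t)) (by
    intro w hw
    right
    have hw2 := (Finset.mem_filter.mp hw).2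
    have hpos : (0 : ℝ) < 2 ^ (-((n : ℝ) * (S - δ))) := by positivity
    rw [sum_log_word (hpos.trans hw2).ne']
    have := Real.log_le_log hpos hw2.le
    rw [hpow] at this; linarith)
  -- Words of weight zero land in this half; they are treated separately because `Real.log 0 = 0`
  -- says nothing about their size.
  have hb₂ := h₂ n (F.filter fun w => ¬ (2 : ℝ) ^ (-((n : ℝ) * (S - δ))) < ∏ t, d (w t)) (by
    intro w hw
    obtain ⟨hwF, hw2⟩ := Finset.mem_filter.mp hw
    by_cases h0 : ∏ t, d (w t) = 0
    · exact Or.inl h0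
    right
    have hlt : ∏ t, d (w t) < 2 ^ (-((n : ℝ) * (S + δ))) := by
      by_contra hcon
      exact hF w hwF ⟨not_lt.mp hcon, not_lt.mp hw2⟩
    rw [Finset.sum_neg_distrib, sum_log_word h0]
    have hpos : 0 < ∏ t, d (w t) :=
      lt_of_le_of_ne (Finset.prod_nonneg fun t _ => hd0 (w t)) (Ne.symm h0)
    have := Real.log_le_log hpos hlt.le
    rw [hpow] at this; linarith)
  rw [← Finset.sum_filter_add_sum_filter_not F
    fun w => (2 : ℝ) ^ (-((n : ℝ) * (S - δ))) < ∏ t, d (w t)]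
  have hn : (0 : ℝ) ≤ n := Nat.cast_nonneg n
  have e₁ : Real.exp (-c₁ * n) ≤ Real.exp (-min c₁ c₂ * n) := by
    apply Real.exp_le_exp.mpr
    have := mul_le_mul_of_nonneg_right (min_le_left c₁ c₂) hn
    linarith
  have e₂ : Real.exp (-c₂ * n) ≤ Real.exp (-min c₁ c₂ * n) := by
    apply Real.exp_le_exp.mpr
    have := mul_le_mul_of_nonneg_right (min_le_right c₁ c₂) hn
    linarith
  linarith

variable [DecidableEq a]

/-- Simultaneous diagonalization of `ρ^{⊗ n}`. -/
theorem exists_diag_state {ρ : Matrix a a ℂ} (hρ : IsState ρ) :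
    ∃ (U : Matrix a a ℂ) (d : a → ℝ), Uᴴ * U = 1 ∧ (∀ i, 0 ≤ d i) ∧ ∑ i, d i = 1 ∧
      ρ = conjDiag U d := by
  obtain ⟨U, d, h1, -, h3, rfl⟩ := exists_conjDiag_nonneg hρ.1
  refine ⟨U, d, h1, h3, ?_, rfl⟩
  have := hρ.2
  rw [conjDiag_trace h1] at this
  exact_mod_cast this

theorem tensorPow_posSemidef {ρ : Matrix a a ℂ} (hρ : ρ.PosSemidef) (n : ℕ) :
    (tensorPow ρ n).PosSemidef := by
  obtain ⟨U, d, h1, -, h3, rfl⟩ := exists_conjDiag_nonneg hρ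
  rw [tensorPow_conjDiag]
  exact conjDiag_posSemidef _ fun w => Finset.prod_nonneg fun t _ => h3 _

theorem tensorPow_trace (ρ : Matrix a a ℂ) (n : ℕ) : (tensorPow ρ n).trace = ρ.trace ^ n := by
  rw [tensorPow_eq, tensorProd_trace]; simp

theorem typicalProj_isHermitian {ρ : Matrix a a ℂ} (hρ : IsState ρ) (δ : ℝ) (n : ℕ) :
    (typicalProj ρ δ n).IsHermitian :=
  cfc_isHermitian _ (tensorPow_posSemidef hρ.1 n).1

theorem typicalProj_mul_self {ρ : Matrix a a ℂ} (hρ : IsState ρ) (δ : ℝ) (n : ℕ) :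
    typicalProj ρ δ n * typicalProj ρ δ n = typicalProj ρ δ n :=
  cfc_indicator_mul_self _ (tensorPow_posSemidef hρ.1 n).1

theorem typicalPart_posSemidef {ρ : Matrix a a ℂ} (hρ : IsState ρ) (δ : ℝ) (n : ℕ) :
    (typicalPart ρ δ n).PosSemidef := by
  have := (tensorPow_posSemidef hρ.1 n).mul_mul_conjTranspose_same (typicalProj ρ δ n)
  rwa [(typicalProj_isHermitian hρ δ n).eq] at this

theorem tensorPow_sub_typicalPart_posSemidef {ρ : Matrix a a ℂ} (hρ : IsState ρ) (δ : ℝ) (n : ℕ) :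
    (tensorPow ρ n - typicalPart ρ δ n).PosSemidef := by
  obtain ⟨U, d, h1, h2, h3, rfl⟩ := exists_diag_state hρ
  have hV := tensorPow_conjTranspose_mul_self h1 n
  rw [typicalPart, typicalProj, tensorPow_conjDiag, cfc_conjDiag hV, conjDiag_mul hV,
    conjDiag_mul hV, sub_eq_add_neg, ← neg_one_smul ℝ (conjDiag _ _), conjDiag_smul, conjDiag_add]
  refine conjDiag_posSemidef _ fun w => ?_
  have := Finset.prod_nonneg fun t (_ : t ∈ Finset.univ) => h2 (w t)
  by_cases h : ∏ t, d (w t) ∈ typicalWindow (entropy (conjDiag U d)) δ n <;> simp [h, this]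

theorem smul_typicalProj_sub_typicalPart_posSemidef {ρ : Matrix a a ℂ} (hρ : IsState ρ) (δ : ℝ)
    (n : ℕ) : ((((2 : ℝ) ^ (-((n : ℝ) * (entropy ρ - δ)))) : ℝ) • typicalProj ρ δ n -
      typicalPart ρ δ n).PosSemidef := by
  obtain ⟨U, d, h1, h2, h3, rfl⟩ := exists_diag_state hρ
  have hV := tensorPow_conjTranspose_mul_self h1 n
  rw [typicalPart, typicalProj, tensorPow_conjDiag, cfc_conjDiag hV, conjDiag_mul hV,
    conjDiag_mul hV, sub_eq_add_neg, ← neg_one_smul ℝ (conjDiag _ _), conjDiag_smul, conjDiag_smul,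
    conjDiag_add]
  refine conjDiag_posSemidef _ fun w => ?_
  by_cases h : ∏ t, d (w t) ∈ typicalWindow (entropy (conjDiag U d)) δ n
  · have := h.2
    simpa [h] using this
  · simp [h]

theorem exists_typicalPart_trace_bound {ρ : Matrix a a ℂ} (hρ : IsState ρ) {δ : ℝ} (hδ : 0 < δ) :
    ∃ c : ℝ, 0 < c ∧ ∀ n : ℕ, 1 - (typicalPart ρ δ n).trace.re ≤ 2 * Real.exp (-c * n) := by
  classical
  obtain ⟨U, d, h1, h2, h3, rfl⟩ := exists_diag_state hρ
  obtain ⟨c, hc, h⟩ := exists_atypical_bound h2 h3 hδ (entropy_conjDiag h1 d)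
  refine ⟨c, hc, fun n => ?_⟩
  refine le_trans (le_of_eq ?_) (h n (Finset.univ.filter fun w =>
    ∏ t, d (w t) ∉ typicalWindow (entropy (conjDiag U d)) δ n) (by simp))
  have hV := tensorPow_conjTranspose_mul_self h1 n
  rw [typicalPart, typicalProj, tensorPow_conjDiag, cfc_conjDiag hV, conjDiag_mul hV,
    conjDiag_mul hV, conjDiag_trace hV, Complex.ofReal_re]
  have hone : (1 : ℝ) = ∑ w : Fin n → a, ∏ t, d (w t) := by rw [sum_prod_word, h3, one_pow]
  rw [show ∀ x : ℝ, 1 - x = ∑ w : Fin n → a, ∏ t, d (w t) - x from fun x => by rw [hone],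
    ← Finset.sum_sub_distrib, Finset.sum_filter]
  refine Finset.sum_congr rfl fun w _ => ?_
  by_cases h : ∏ t, d (w t) ∈ typicalWindow (entropy (conjDiag U d)) δ n <;> simp [h]

end Typicality

/-! ### Ranks of support projectors. -/

section Support

variable {m : Type*} [Fintype m] [DecidableEq m]

theorem trace_suppProj_eq_rank {X : Matrix m m ℂ} (hX : X.IsHermitian) :
    (suppProj X).trace.re = X.rank := by
  classical
  have hU : (hX.eigenvectorUnitary : Matrix m m ℂ)ᴴ * (hX.eigenvectorUnitary : Matrix m m ℂ) = 1 :=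
    Unitary.coe_star_mul_self hX.eigenvectorUnitary
  have h : X = conjDiag hX.eigenvectorUnitary hX.eigenvalues := by
    conv_lhs => rw [hX.spectral_theorem]
    rfl
  have h2 : suppProj X = conjDiag hX.eigenvectorUnitary fun i =>
      ({0}ᶜ : Set ℝ).indicator (fun _ => (1 : ℝ)) (hX.eigenvalues i) := by
    rw [← cfc_conjDiag hU, ← h, suppProj]
  rw [h2, conjDiag_trace hU, Complex.ofReal_re, hX.rank_eq_card_non_zero_eigs,
    Fintype.card_subtype, Finset.card_filter]
  push_cast
  refine Finset.sum_congr rfl fun i _ => ?_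
  by_cases h : hX.eigenvalues i = 0 <;> simp [h]

/-- The sum is V V† for the matrix V whose columns are the vectors. -/
theorem rank_sum_ketBra_le {ι : Type*} (F : Finset ι) (v : ι → m → ℂ) :
    (∑ k ∈ F, ketBra (v k)).rank ≤ F.card := by
  have h : ∑ k ∈ F, ketBra (v k) =
      (Matrix.of fun x (k : F) => v k x) * (Matrix.of fun x (k : F) => v k x)ᴴ := by
    ext x y
    rw [Matrix.sum_apply, Matrix.mul_apply, ← Finset.sum_coe_sort F]
    rfl
  rw [h]
  refine (Matrix.rank_mul_le_left _ _).trans ((Matrix.rank_le_card_width _).trans ?_)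
  simp

theorem ketBra_posSemidef (α : m → ℂ) : (ketBra α).PosSemidef :=
  Matrix.posSemidef_vecMulVec_self_star α

theorem trace_ketBra (α : m → ℂ) : (ketBra α).trace = ((∑ i, ‖α i‖ ^ 2 : ℝ) : ℂ) := by
  rw [Matrix.trace, Complex.ofReal_sum]
  refine Finset.sum_congr rfl fun i _ => ?_
  rw [Matrix.diag_apply, ketBra, Matrix.vecMulVec_apply, Pi.star_apply, RCLike.star_def,
    Complex.mul_conj, Complex.normSq_eq_norm_sq]

theorem mul_ketBra_mul_conjTranspose {l : Type*} (F : Matrix l m ℂ) (α : m → ℂ) :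
    F * ketBra α * Fᴴ = ketBra (F *ᵥ α) := by
  rw [ketBra, ketBra, Matrix.mul_vecMulVec, Matrix.vecMulVec_mul, Matrix.star_mulVec]

end Support

/-! ### Typical Kraus words. -/

section Environment

variable {κ a b : Type*} [Fintype κ] [DecidableEq κ] [Fintype a] [DecidableEq a]
  [Fintype b] [DecidableEq b] {A : κ → Matrix b a ℂ} {ρ : Matrix a a ℂ}

theorem envState_diag_nonneg (hρ : IsState ρ) (k : κ) : 0 ≤ envState A ρ k k :=
  (hρ.1.mul_mul_conjTranspose_same (A k)).trace_nonneg

theorem envState_diag_eq (hρ : IsState ρ) (k : κ) :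
    envState A ρ k k = (((envState A ρ k k).re : ℝ) : ℂ) :=
  Complex.ext rfl (Complex.le_def.mp (envState_diag_nonneg hρ k)).2.symm

/-- Here the choice of Kraus operators enters: the diagonal entries are the eigenvalues of ρ_E, so
the Kraus word distribution has entropy S_E. -/
theorem envState_eq_conjDiag (hρ : IsState ρ)
    (hE : ∀ k l, k ≠ l → Matrix.trace (A k * ρ * (A l)ᴴ) = 0) :
    envState A ρ = conjDiag 1 fun k => (envState A ρ k k).re := by
  ext k l
  by_cases h : k = l
  · subst h
    simpa [conjDiag] using envState_diag_eq hρ k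
  · simpa [conjDiag, h, envState] using hE k l h

theorem tensorPow_envState_re (hρ : IsState ρ) (n : ℕ) (k : Fin n → κ) :
    (tensorPow (envState A ρ) n k k).re = ∏ t, (envState A ρ (k t) (k t)).re := by
  have h : tensorPow (envState A ρ) n k k =
      ((∏ t, (envState A ρ (k t) (k t)).re : ℝ) : ℂ) := by
    rw [Complex.ofReal_prod, tensorPow, Matrix.of_apply]
    exact Finset.prod_congr rfl fun t _ => envState_diag_eq hρ _
  rw [h, Complex.ofReal_re]

theorem sum_envState_diag (hA : IsChannel A) (hρ : IsState ρ) :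
    ∑ k, (envState A ρ k k).re = 1 := by
  have h := trace_envState A ρ
  rw [trace_krausMap hA, hρ.2] at h
  have h2 := congrArg Complex.re h
  rwa [Matrix.trace, Complex.re_sum, Complex.one_re] at h2

open Classical in
theorem exists_atypicalEnv_bound (hA : IsChannel A) (hρ : IsState ρ)
    (hE : ∀ k l, k ≠ l → Matrix.trace (A k * ρ * (A l)ᴴ) = 0) {δ : ℝ} (hδ : 0 < δ) :
    ∃ c : ℝ, 0 < c ∧ ∀ n : ℕ, ∑ k : Fin n → κ with ¬ IsTypicalEnv A ρ δ n k,
      (tensorPow (envState A ρ) n k k).re ≤ 2 * Real.exp (-c * n) := by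
  have hS := entropy_conjDiag (U := (1 : Matrix κ κ ℂ)) (by simp)
    fun k => (envState A ρ k k).re
  rw [← envState_eq_conjDiag hρ hE] at hS
  obtain ⟨c, hc, h⟩ := exists_atypical_bound
    (fun k => (Complex.le_def.mp (envState_diag_nonneg (A := A) hρ k)).1)
    (sum_envState_diag hA hρ) hδ hS
  refine ⟨c, hc, fun n => ?_⟩
  simp only [tensorPow_envState_re hρ]
  refine h n _ fun k hk => ?_
  have := (Finset.mem_filter.mp hk).2
  rwa [IsTypicalEnv, tensorPow_envState_re hρ] at this

-- Every typical word has weight at least 2^{-n(S_E+δ)}, and all weights sum to one.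
open Classical in
theorem card_typicalEnv_le (hA : IsChannel A) (hρ : IsState ρ) (δ : ℝ) (n : ℕ) :
    ((Finset.univ.filter fun k : Fin n → κ => IsTypicalEnv A ρ δ n k).card : ℝ) ≤
      2 ^ ((n : ℝ) * (entropy (envState A ρ) + δ)) := by
  set S := entropy (envState A ρ)
  set F := Finset.univ.filter fun k : Fin n → κ => IsTypicalEnv A ρ δ n k
  have h1 : F.card • (2 : ℝ) ^ (-((n : ℝ) * (S + δ))) ≤
      ∑ k ∈ F, (tensorPow (envState A ρ) n k k).re :=
    Finset.card_nsmul_le_sum _ _ _ fun k hk => (Finset.mem_filter.mp hk).2.1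
  have h2 : ∑ k ∈ F, (tensorPow (envState A ρ) n k k).re ≤ 1 := by
    simp only [tensorPow_envState_re hρ]
    refine (Finset.sum_le_univ_sum_of_nonneg fun k => Finset.prod_nonneg fun t _ =>
      (Complex.le_def.mp (envState_diag_nonneg (A := A) hρ _)).1).trans (le_of_eq ?_)
    rw [sum_prod_word (fun k => (envState A ρ k k).re), sum_envState_diag hA hρ, one_pow]
  have h3 := h1.trans h2
  rw [nsmul_eq_mul, Real.rpow_neg two_pos.le, ← div_eq_mul_inv,
    div_le_one (by positivity)] at h3
  exact h3

end Environment

/-! ### The projected channel and its weight on the typical input. -/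

section Output

variable {κ a b : Type*} [Fintype κ] [DecidableEq κ] [Fintype a] [DecidableEq a]
  [Fintype b] [DecidableEq b]

open Classical in
/-- The completely positive map `X ↦ ∑_{k typical} Π_B A_k X A_k† Π_B`. -/
def typMap (A : κ → Matrix b a ℂ) (ρ : Matrix a a ℂ) (δ : ℝ) (n : ℕ)
    (X : Matrix (Fin n → a) (Fin n → a) ℂ) : Matrix (Fin n → b) (Fin n → b) ℂ :=
  ∑ k : Fin n → κ with IsTypicalEnv A ρ δ n k,
    (typicalProj (krausMap A ρ) δ n * krausPow A n k) * X *
      (typicalProj (krausMap A ρ) δ n * krausPow A n k)ᴴ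

variable {A : κ → Matrix b a ℂ} {ρ : Matrix a a ℂ} {δ : ℝ} {n : ℕ}

theorem bobOutTyp_eq (α : (Fin n → a) → ℂ) :
    bobOutTyp A ρ δ n α = typMap A ρ δ n (ketBra α) := rfl

theorem typMap_add (X Y : Matrix (Fin n → a) (Fin n → a) ℂ) :
    typMap A ρ δ n (X + Y) = typMap A ρ δ n X + typMap A ρ δ n Y := by
  simp only [typMap, Matrix.mul_add, Matrix.add_mul, Finset.sum_add_distrib]

theorem typMap_smul (z : ℂ) (X : Matrix (Fin n → a) (Fin n → a) ℂ) :
    typMap A ρ δ n (z • X) = z • typMap A ρ δ n X := by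
  simp only [typMap, Matrix.mul_smul, Matrix.smul_mul, Finset.smul_sum]

theorem typMap_posSemidef {X : Matrix (Fin n → a) (Fin n → a) ℂ} (hX : X.PosSemidef) :
    (typMap A ρ δ n X).PosSemidef :=
  Matrix.posSemidef_sum _ fun _ _ => hX.mul_mul_conjTranspose_same _

/-- The part of the channel output that comes from typical Kraus operators. -/
theorem typMap_eq (hA : IsChannel A) (hρ : IsState ρ) (X : Matrix (Fin n → a) (Fin n → a) ℂ)
    [DecidablePred (IsTypicalEnv A ρ δ n)] :
    typMap A ρ δ n X = typicalProj (krausMap A ρ) δ n *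
      (∑ k : Fin n → κ with IsTypicalEnv A ρ δ n k, krausPow A n k * X * (krausPow A n k)ᴴ) *
      typicalProj (krausMap A ρ) δ n := by
  rw [typMap, Finset.mul_sum, Finset.sum_mul]
  refine Finset.sum_congr (by congr!) fun k _ => ?_
  rw [Matrix.conjTranspose_mul, (typicalProj_isHermitian (isState_krausMap hA hρ) δ n).eq]
  simp only [Matrix.mul_assoc]

theorem krausMap_sub_typical_posSemidef {X : Matrix (Fin n → a) (Fin n → a) ℂ}
    (hX : X.PosSemidef) [DecidablePred (IsTypicalEnv A ρ δ n)] :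
    (krausMap (krausPow A n) X - ∑ k : Fin n → κ with IsTypicalEnv A ρ δ n k,
      krausPow A n k * X * (krausPow A n k)ᴴ).PosSemidef := by
  rw [krausMap, ← Finset.sum_filter_add_sum_filter_not Finset.univ (IsTypicalEnv A ρ δ n),
    add_sub_cancel_left]
  exact Matrix.posSemidef_sum _ fun k _ => hX.mul_mul_conjTranspose_same _

theorem proj_mul_typMap (hA : IsChannel A) (hρ : IsState ρ)
    (X : Matrix (Fin n → a) (Fin n → a) ℂ) :
    typicalProj (krausMap A ρ) δ n * typMap A ρ δ n X = typMap A ρ δ n X := by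
  classical
  rw [typMap_eq hA hρ, ← Matrix.mul_assoc, ← Matrix.mul_assoc,
    typicalProj_mul_self (isState_krausMap hA hρ)]

/-- For operators `Z = Π_B Z Π_B` the projected output gives at most the weight of the actual
output. -/
theorem trace_typMap_mul_le (hA : IsChannel A) (hρ : IsState ρ)
    {X : Matrix (Fin n → a) (Fin n → a) ℂ} (hX : X.PosSemidef)
    {Z : Matrix (Fin n → b) (Fin n → b) ℂ} (hZ : Z.PosSemidef)
    (h : typicalProj (krausMap A ρ) δ n * Z * typicalProj (krausMap A ρ) δ n = Z) :
    (typMap A ρ δ n X * Z).trace.re ≤ (krausMap (krausPow A n) X * Z).trace.re := by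
  classical
  have h1 := trace_mul_re_nonneg (krausMap_sub_typical_posSemidef (A := A) (ρ := ρ) (δ := δ) hX) hZ
  have h2 : (typMap A ρ δ n X * Z).trace = ((∑ k : Fin n → κ with IsTypicalEnv A ρ δ n k,
      krausPow A n k * X * (krausPow A n k)ᴴ) * Z).trace := by
    rw [typMap_eq hA hρ, Matrix.mul_assoc, Matrix.mul_assoc, Matrix.trace_mul_comm]
    conv_rhs => rw [← h]
    simp only [Matrix.mul_assoc]
  rw [Matrix.sub_mul, Matrix.trace_sub, Complex.sub_re, ← h2] at h1
  linarith

theorem proj_posSemidef (hA : IsChannel A) (hρ : IsState ρ) :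
    (typicalProj (krausMap A ρ) δ n).PosSemidef :=
  posSemidef_of_idem (typicalProj_isHermitian (isState_krausMap hA hρ) δ n)
    (typicalProj_mul_self (isState_krausMap hA hρ) δ n)

theorem one_sub_proj_posSemidef (hA : IsChannel A) (hρ : IsState ρ) :
    (1 - typicalProj (krausMap A ρ) δ n).PosSemidef :=
  one_sub_posSemidef_of_idem (typicalProj_isHermitian (isState_krausMap hA hρ) δ n)
    (typicalProj_mul_self (isState_krausMap hA hρ) δ n)

theorem trace_proj_conj (hA : IsChannel A) (hρ : IsState ρ)
    (Z : Matrix (Fin n → b) (Fin n → b) ℂ) :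
    (typicalProj (krausMap A ρ) δ n * Z * typicalProj (krausMap A ρ) δ n).trace =
      (typicalProj (krausMap A ρ) δ n * Z).trace := by
  rw [Matrix.trace_mul_comm, ← Matrix.mul_assoc, typicalProj_mul_self (isState_krausMap hA hρ)]

theorem trace_proj_mul_le (hA : IsChannel A) (hρ : IsState ρ)
    {Z : Matrix (Fin n → b) (Fin n → b) ℂ} (hZ : Z.PosSemidef) :
    (typicalProj (krausMap A ρ) δ n * Z).trace.re ≤ Z.trace.re := by
  have h := trace_mul_re_nonneg (one_sub_proj_posSemidef (δ := δ) (n := n) hA hρ) hZ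
  rw [Matrix.sub_mul, Matrix.one_mul, Matrix.trace_sub, Complex.sub_re] at h
  linarith

theorem trace_typMap_le (hA : IsChannel A) (hρ : IsState ρ)
    {X : Matrix (Fin n → a) (Fin n → a) ℂ} (hX : X.PosSemidef) :
    (typMap A ρ δ n X).trace.re ≤ X.trace.re := by
  have h1 := trace_typMap_mul_le (δ := δ) hA hρ hX (proj_posSemidef (n := n) hA hρ) (by
    rw [typicalProj_mul_self (isState_krausMap hA hρ),
      typicalProj_mul_self (isState_krausMap hA hρ)])
  rw [Matrix.trace_mul_comm, proj_mul_typMap hA hρ, Matrix.trace_mul_comm] at h1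
  refine h1.trans ((trace_proj_mul_le hA hρ (krausMap_posSemidef _ hX)).trans (le_of_eq ?_))
  rw [trace_krausMap (isChannel_krausPow hA n)]

open Classical in
/-- The projected output of the typical input has almost full weight. -/
theorem trace_typMap_typicalPart_ge (hA : IsChannel A) (hρ : IsState ρ) :
    1 - (1 - (typicalPart ρ δ n).trace.re) - (1 - (typicalPart (krausMap A ρ) δ n).trace.re) -
        ∑ k : Fin n → κ with ¬ IsTypicalEnv A ρ δ n k, (tensorPow (envState A ρ) n k k).re ≤
      (typMap A ρ δ n (typicalPart ρ δ n)).trace.re := by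
  have hB := isState_krausMap hA hρ
  -- The loss splits in two: replacing ρ^{⊗n} by its typical part costs at most the missing input
  -- weight, and on ρ^{⊗n} itself only output projection and atypical Kraus words remain.
  have h1 := trace_typMap_le (δ := δ) hA hρ (tensorPow_sub_typicalPart_posSemidef hρ δ n)
  have hsplit : typMap A ρ δ n (tensorPow ρ n) = typMap A ρ δ n (typicalPart ρ δ n) +
      typMap A ρ δ n (tensorPow ρ n - typicalPart ρ δ n) := by
    rw [← typMap_add, add_sub_cancel]
  have htr := congrArg (fun X => X.trace.re) hsplit
  simp only [Matrix.trace_add, Complex.add_re] at htr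
  rw [Matrix.trace_sub, Complex.sub_re, tensorPow_trace, hρ.2, one_pow, Complex.one_re] at h1
  have hmain : (typicalPart (krausMap A ρ) δ n).trace.re ≤
      (typMap A ρ δ n (tensorPow ρ n)).trace.re +
      ∑ k : Fin n → κ with ¬ IsTypicalEnv A ρ δ n k, (tensorPow (envState A ρ) n k k).re := by
    have e1 : typicalPart (krausMap A ρ) δ n = typMap A ρ δ n (tensorPow ρ n) +
        typicalProj (krausMap A ρ) δ n * (∑ k : Fin n → κ with ¬ IsTypicalEnv A ρ δ n k,
          krausPow A n k * tensorPow ρ n * (krausPow A n k)ᴴ) *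
          typicalProj (krausMap A ρ) δ n := by
      rw [typMap_eq hA hρ, ← Matrix.add_mul, ← Matrix.mul_add,
        Finset.sum_filter_add_sum_filter_not, typicalPart, ← krausMap_krausPow_tensorPow]
      rfl
    rw [e1, Matrix.trace_add, Complex.add_re, trace_proj_conj hA hρ]
    gcongr
    refine (trace_proj_mul_le hA hρ (Matrix.posSemidef_sum _ fun k _ =>
      (tensorPow_posSemidef hρ.1 n).mul_mul_conjTranspose_same _)).trans (le_of_eq ?_)
    rw [Matrix.trace_sum, Complex.re_sum]
    simp only [trace_krausPow]
  linarith

/-- The projected output of the typical input is bounded by the largest typical eigenvalue. -/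
theorem trace_typMap_typicalPart_mul_le (hA : IsChannel A) (hρ : IsState ρ)
    {Z : Matrix (Fin n → b) (Fin n → b) ℂ} (hZ : Z.PosSemidef) :
    (typMap A ρ δ n (typicalPart ρ δ n) * Z).trace.re ≤
      (2 : ℝ) ^ (-((n : ℝ) * (entropy (krausMap A ρ) - δ))) * Z.trace.re := by
  classical
  have hB := isState_krausMap hA hρ
  have h1 := trace_mul_re_nonneg (typMap_posSemidef (A := A) (ρ := ρ) (δ := δ)
    (tensorPow_sub_typicalPart_posSemidef hρ δ n)) hZ
  have hsplit : typMap A ρ δ n (tensorPow ρ n) = typMap A ρ δ n (typicalPart ρ δ n) +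
      typMap A ρ δ n (tensorPow ρ n - typicalPart ρ δ n) := by
    rw [← typMap_add, add_sub_cancel]
  -- The chain of operator inequalities tested against Z is: projected output of the typical input ≤
  -- that of ρ^{⊗n} ≤ Π_B ρ_B^{⊗n} Π_B ≤ 2^{-n(S_B-δ)} Π_B.
  have h2 : (typicalPart (krausMap A ρ) δ n - typMap A ρ δ n (tensorPow ρ n)).PosSemidef := by
    have h := (krausMap_sub_typical_posSemidef (A := A) (ρ := ρ) (δ := δ)
      (tensorPow_posSemidef hρ.1 n)).mul_mul_conjTranspose_same (typicalProj (krausMap A ρ) δ n)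
    rwa [(typicalProj_isHermitian hB δ n).eq, Matrix.mul_sub, Matrix.sub_mul, ← typMap_eq hA hρ,
      krausMap_krausPow_tensorPow] at h
  have h3 := trace_mul_re_nonneg h2 hZ
  have h4 := trace_mul_re_nonneg (smul_typicalProj_sub_typicalPart_posSemidef hB δ n) hZ
  have h5 := trace_proj_mul_le (δ := δ) hA hρ hZ
  rw [hsplit, Matrix.sub_mul, Matrix.add_mul, Matrix.trace_sub, Matrix.trace_add, Complex.sub_re,
    Complex.add_re] at h3
  rw [Matrix.sub_mul, Matrix.trace_sub, Complex.sub_re, Matrix.smul_mul, Matrix.trace_smul,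
    Complex.smul_re, smul_eq_mul] at h4
  have h6 := mul_le_mul_of_nonneg_left h5
    (show (0 : ℝ) ≤ 2 ^ (-((n : ℝ) * (entropy (krausMap A ρ) - δ))) by positivity)
  linarith

end Output

/-! ### Detectors and the error of a fixed code. -/

section Detectors

variable {κ a b : Type*} [Fintype κ] [DecidableEq κ] [Fintype a] [DecidableEq a]
  [Fintype b] [DecidableEq b] {A : κ → Matrix b a ℂ} {ρ : Matrix a a ℂ} {δ : ℝ} {n : ℕ}

theorem bobOutTyp_posSemidef (α : (Fin n → a) → ℂ) : (bobOutTyp A ρ δ n α).PosSemidef :=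
  typMap_posSemidef (ketBra_posSemidef α)

theorem proj_mul_suppProj_bobOutTyp (hA : IsChannel A) (hρ : IsState ρ) (α : (Fin n → a) → ℂ) :
    typicalProj (krausMap A ρ) δ n * suppProj (bobOutTyp A ρ δ n α) =
      suppProj (bobOutTyp A ρ δ n α) :=
  mul_suppProj_of_mul_eq (bobOutTyp_posSemidef α).1 (proj_mul_typMap hA hρ _)

/-- The projected output already lies in Bob's typical space, so the sandwiched Π_B acts trivially
and the detectors are genuine projectors. -/
theorem detector_eq (hA : IsChannel A) (hρ : IsState ρ) (α : (Fin n → a) → ℂ) :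
    detector A ρ δ n α = suppProj (bobOutTyp A ρ δ n α) := by
  rw [detector, Matrix.mul_assoc, proj_mul_suppProj_bobOutTyp hA hρ,
    suppProj_mul_self (bobOutTyp_posSemidef α).1]

theorem detector_isHermitian (hA : IsChannel A) (hρ : IsState ρ) (α : (Fin n → a) → ℂ) :
    (detector A ρ δ n α).IsHermitian := by
  rw [detector_eq hA hρ]; exact suppProj_isHermitian (bobOutTyp_posSemidef α).1

theorem detector_mul_self (hA : IsChannel A) (hρ : IsState ρ) (α : (Fin n → a) → ℂ) :
    detector A ρ δ n α * detector A ρ δ n α = detector A ρ δ n α := by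
  rw [detector_eq hA hρ]; exact suppProj_mul_self (bobOutTyp_posSemidef α).1

theorem detector_posSemidef (hA : IsChannel A) (hρ : IsState ρ) (α : (Fin n → a) → ℂ) :
    (detector A ρ δ n α).PosSemidef :=
  posSemidef_of_idem (detector_isHermitian hA hρ α) (detector_mul_self hA hρ α)

theorem detector_mul_bobOutTyp (hA : IsChannel A) (hρ : IsState ρ) (α : (Fin n → a) → ℂ) :
    detector A ρ δ n α * bobOutTyp A ρ δ n α = bobOutTyp A ρ δ n α := by
  rw [detector_eq hA hρ]; exact suppProj_mul (bobOutTyp_posSemidef α).1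

theorem trace_detector_le (hA : IsChannel A) (hρ : IsState ρ) (α : (Fin n → a) → ℂ) :
    (detector A ρ δ n α).trace.re ≤ 2 ^ ((n : ℝ) * (entropy (envState A ρ) + δ)) := by
  classical
  rw [detector_eq hA hρ, trace_suppProj_eq_rank (bobOutTyp_posSemidef α).1]
  refine le_trans ?_ (card_typicalEnv_le hA hρ δ n)
  have h : bobOutTyp A ρ δ n α = ∑ k : Fin n → κ with IsTypicalEnv A ρ δ n k,
      ketBra ((typicalProj (krausMap A ρ) δ n * krausPow A n k) *ᵥ α) := by
    rw [bobOutTyp]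
    exact Finset.sum_congr (by congr!) fun k _ => mul_ketBra_mul_conjTranspose _ _
  rw [h]
  exact_mod_cast rank_sum_ketBra_le _ _

variable {N : ℕ}

theorem sqrtMeas_posSemidef (hA : IsChannel A) (hρ : IsState ρ) (c : Fin N → (Fin n → a) → ℂ)
    (i : Fin N) : (sqrtMeas A ρ δ n c i).PosSemidef :=
  posSemidef_conj_invSqrt (sum_posSemidef fun j => detector_posSemidef hA hρ (c j)).1
    (detector_posSemidef hA hρ (c i))

theorem one_sub_sum_sqrtMeas_posSemidef (hA : IsChannel A) (hρ : IsState ρ)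
    (c : Fin N → (Fin n → a) → ℂ) : (1 - ∑ i, sqrtMeas A ρ δ n c i).PosSemidef :=
  one_sub_sum_conj_invSqrt_posSemidef fun j => detector_posSemidef hA hρ (c j)

theorem one_sub_sqrtMeas_posSemidef (hA : IsChannel A) (hρ : IsState ρ)
    (c : Fin N → (Fin n → a) → ℂ) (i : Fin N) : (1 - sqrtMeas A ρ δ n c i).PosSemidef := by
  have : 1 - sqrtMeas A ρ δ n c i = (1 - ∑ j, sqrtMeas A ρ δ n c j) +
      ∑ j ∈ Finset.univ.erase i, sqrtMeas A ρ δ n c j := by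
    rw [← Finset.add_sum_erase _ (sqrtMeas A ρ δ n c) (Finset.mem_univ i)]; abel
  rw [this]
  exact (one_sub_sum_sqrtMeas_posSemidef hA hρ c).add
    (Matrix.posSemidef_sum _ fun j _ => sqrtMeas_posSemidef hA hρ c j)

/-- This makes the projected success weight a lower bound for the actual one: Π_B can be absorbed
into the measurement. -/
theorem proj_conj_sqrtMeas (hA : IsChannel A) (hρ : IsState ρ) (c : Fin N → (Fin n → a) → ℂ)
    (i : Fin N) : typicalProj (krausMap A ρ) δ n * sqrtMeas A ρ δ n c i *
      typicalProj (krausMap A ρ) δ n = sqrtMeas A ρ δ n c i := by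
  have hG := sum_posSemidef fun j => detector_posSemidef (δ := δ) hA hρ (c j)
  have h1 : typicalProj (krausMap A ρ) δ n * invSqrt (∑ j, detector A ρ δ n (c j)) =
      invSqrt (∑ j, detector A ρ δ n (c j)) := by
    refine mul_invSqrt_of_mul_eq hG ?_
    rw [Finset.mul_sum]
    refine Finset.sum_congr rfl fun j _ => ?_
    rw [detector_eq hA hρ, proj_mul_suppProj_bobOutTyp hA hρ]
  have h2 := congrArg Matrix.conjTranspose h1
  rw [Matrix.conjTranspose_mul, (typicalProj_isHermitian (isState_krausMap hA hρ) δ n).eq,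
    (invSqrt_isHermitian hG.1).eq] at h2
  rw [sqrtMeas]
  calc _ = (typicalProj (krausMap A ρ) δ n * invSqrt (∑ j, detector A ρ δ n (c j))) *
        detector A ρ δ n (c i) * (invSqrt (∑ j, detector A ρ δ n (c j)) *
        typicalProj (krausMap A ρ) δ n) := by simp only [Matrix.mul_assoc]
    _ = _ := by rw [h1, h2]

theorem trace_bobOutTyp_sqrtMeas_nonneg (hA : IsChannel A) (hρ : IsState ρ)
    (c : Fin N → (Fin n → a) → ℂ) (i : Fin N) :
    0 ≤ (bobOutTyp A ρ δ n (c i) * sqrtMeas A ρ δ n c i).trace.re :=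
  trace_mul_re_nonneg (bobOutTyp_posSemidef _) (sqrtMeas_posSemidef hA hρ c i)

theorem trace_bobOutTyp_sqrtMeas_le (hA : IsChannel A) (hρ : IsState ρ)
    (c : Fin N → (Fin n → a) → ℂ) (i : Fin N) :
    (bobOutTyp A ρ δ n (c i) * sqrtMeas A ρ δ n c i).trace.re ≤
      (bobOut A n (c i) * sqrtMeas A ρ δ n c i).trace.re :=
  trace_typMap_mul_le hA hρ (ketBra_posSemidef _) (sqrtMeas_posSemidef hA hρ c i)
    (proj_conj_sqrtMeas hA hρ c i)

theorem bobOut_posSemidef (α : (Fin n → a) → ℂ) : (bobOut A n α).PosSemidef :=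
  krausMap_posSemidef _ (ketBra_posSemidef α)

theorem trace_bobOut (hA : IsChannel A) (α : (Fin n → a) → ℂ) :
    (bobOut A n α).trace = ((∑ i, ‖α i‖ ^ 2 : ℝ) : ℂ) := by
  rw [bobOut, trace_krausMap (isChannel_krausPow hA n), trace_ketBra]

theorem trace_bobOut_sqrtMeas_le (hA : IsChannel A) (hρ : IsState ρ)
    (c : Fin N → (Fin n → a) → ℂ) (i : Fin N) :
    (bobOut A n (c i) * sqrtMeas A ρ δ n c i).trace.re ≤ ∑ x, ‖c i x‖ ^ 2 := by
  have h := trace_mul_re_nonneg (bobOut_posSemidef (A := A) (c i))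
    (one_sub_sqrtMeas_posSemidef (δ := δ) hA hρ c i)
  rw [Matrix.mul_sub, Matrix.mul_one, Matrix.trace_sub, Complex.sub_re, trace_bobOut hA,
    Complex.ofReal_re] at h
  linarith

theorem errActual_le_errTyp (hA : IsChannel A) (hρ : IsState ρ) (c : Fin N → (Fin n → a) → ℂ) :
    errActual A ρ δ n c ≤ errTyp A ρ δ n c := by
  have h := mul_le_mul_of_nonneg_left (Finset.sum_le_sum fun i (_ : i ∈ Finset.univ) =>
    trace_bobOutTyp_sqrtMeas_le (δ := δ) hA hρ c i) (show 0 ≤ 1 / (N : ℝ) by positivity)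
  rw [errActual, errTyp]
  linarith

theorem errTyp_le_one (hA : IsChannel A) (hρ : IsState ρ) (c : Fin N → (Fin n → a) → ℂ) :
    errTyp A ρ δ n c ≤ 1 := by
  have h := mul_nonneg (show 0 ≤ 1 / (N : ℝ) by positivity)
    (Finset.sum_nonneg fun i (_ : i ∈ Finset.univ) =>
      trace_bobOutTyp_sqrtMeas_nonneg (δ := δ) hA hρ c i)
  rw [errTyp]
  linarith

/-- Codewords need not be normalized, so the error can be negative; this bound provides the
integrable minorant. -/
theorem errActual_ge (hA : IsChannel A) (hρ : IsState ρ) (c : Fin N → (Fin n → a) → ℂ) :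
    1 - (1 / (N : ℝ)) * ∑ i, ∑ x, ‖c i x‖ ^ 2 ≤ errActual A ρ δ n c := by
  have h := mul_le_mul_of_nonneg_left (Finset.sum_le_sum fun i (_ : i ∈ Finset.univ) =>
    trace_bobOut_sqrtMeas_le (δ := δ) hA hρ c i) (show 0 ≤ 1 / (N : ℝ) by positivity)
  rw [errActual]
  linarith

/-- The error of the square-root measurement is controlled by the overlaps of the detectors. -/
theorem errTyp_le (hA : IsChannel A) (hρ : IsState ρ) (c : Fin N → (Fin n → a) → ℂ) :
    errTyp A ρ δ n c ≤ 1 - (1 / (N : ℝ)) * ∑ i, (bobOutTyp A ρ δ n (c i)).trace.re +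
      (1 / (N : ℝ)) * ∑ i, ∑ j ∈ Finset.univ.erase i,
        (bobOutTyp A ρ δ n (c i) * detector A ρ δ n (c j)).trace.re := by
  have h1 : ∀ i, (bobOutTyp A ρ δ n (c i)).trace.re - ∑ j ∈ Finset.univ.erase i,
      (bobOutTyp A ρ δ n (c i) * detector A ρ δ n (c j)).trace.re ≤
      (bobOutTyp A ρ δ n (c i) * sqrtMeas A ρ δ n c i).trace.re := by
    intro i
    have h := trace_mul_conj_invSqrt_ge (fun j => detector_isHermitian (δ := δ) hA hρ (c j))
      (fun j => detector_mul_self hA hρ (c j)) i (bobOutTyp_posSemidef (c i))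
      (detector_mul_bobOutTyp hA hρ (c i))
    have h2 : (bobOutTyp A ρ δ n (c i) * detector A ρ δ n (c i)).trace =
        (bobOutTyp A ρ δ n (c i)).trace := by
      rw [Matrix.trace_mul_comm, detector_mul_bobOutTyp hA hρ]
    rw [Finset.mul_sum, Matrix.trace_sum, Complex.re_sum,
      ← Finset.add_sum_erase _ _ (Finset.mem_univ i), h2] at h
    rw [sqrtMeas]
    linarith
  have h2 := mul_le_mul_of_nonneg_left (Finset.sum_le_sum fun i (_ : i ∈ Finset.univ) => h1 i)
    (show 0 ≤ 1 / (N : ℝ) by positivity)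
  rw [Finset.sum_sub_distrib, mul_sub] at h2
  rw [errTyp]
  linarith

end Detectors

/-! ### Measurability of functional calculus. -/

section Measurability

open Filter Topology

/-- Weierstrass approximation on the growing intervals [-k, k], with error 1/(k+1), turns a
pointwise limit of continuous functions into one of polynomials. -/
theorem exists_polynomial_tendsto {f : ℝ → ℝ} {g : ℕ → ℝ → ℝ} (hg : ∀ k, Continuous (g k))
    (h : ∀ x, Tendsto (fun k => g k x) atTop (𝓝 (f x))) :
    ∃ p : ℕ → Polynomial ℝ, ∀ x, Tendsto (fun k => (p k).eval x) atTop (𝓝 (f x)) := by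
  have h1 : ∀ k : ℕ, ∃ p : Polynomial ℝ, ∀ x ∈ Set.Icc (-(k : ℝ)) k,
      |p.eval x - g k x| < 1 / ((k : ℝ) + 1) := fun k =>
    exists_polynomial_near_of_continuousOn _ _ _ (hg k).continuousOn _ (by positivity)
  choose p hp using h1
  refine ⟨p, fun x => ?_⟩
  have h2 : Tendsto (fun k => (p k).eval x - g k x) atTop (𝓝 0) := by
    refine squeeze_zero_norm' ?_ tendsto_one_div_add_atTop_nhds_zero_nat
    obtain ⟨K, hK⟩ := exists_nat_ge |x|
    filter_upwards [eventually_ge_atTop K] with k hk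
    have hxk : |x| ≤ k := hK.trans (by exact_mod_cast hk)
    exact (hp k x (abs_le.mp hxk)).le
  simpa using h2.add (h x)

variable {Ω l m n : Type*} [MeasurableSpace Ω]

/-- A matrix-valued function with measurable entries. -/
def MeasEntries (X : Ω → Matrix l m ℂ) : Prop := ∀ i j, Measurable fun ω => X ω i j

theorem MeasEntries.const (M : Matrix l m ℂ) : MeasEntries fun _ : Ω => M :=
  fun _ _ => measurable_const

theorem MeasEntries.sum {ι : Type*} (F : Finset ι) {X : ι → Ω → Matrix l m ℂ}
    (h : ∀ k ∈ F, MeasEntries (X k)) : MeasEntries fun ω => ∑ k ∈ F, X k ω := by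
  intro i j
  simp only [Matrix.sum_apply]
  exact Finset.measurable_sum _ fun k hk => h k hk i j

theorem MeasEntries.add {X Y : Ω → Matrix l m ℂ} (hX : MeasEntries X) (hY : MeasEntries Y) :
    MeasEntries fun ω => X ω + Y ω := fun i j => (hX i j).add (hY i j)

theorem MeasEntries.mul [Fintype m] {X : Ω → Matrix l m ℂ} {Y : Ω → Matrix m n ℂ}
    (hX : MeasEntries X) (hY : MeasEntries Y) : MeasEntries fun ω => X ω * Y ω := by
  intro i j
  simp only [Matrix.mul_apply]
  exact Finset.measurable_sum _ fun k _ => (hX i k).mul (hY k j)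

theorem MeasEntries.smul (z : ℂ) {X : Ω → Matrix l m ℂ} (hX : MeasEntries X) :
    MeasEntries fun ω => z • X ω := fun i j => (hX i j).const_mul z

theorem MeasEntries.comp {Ω' : Type*} [MeasurableSpace Ω'] {X : Ω → Matrix l m ℂ}
    (hX : MeasEntries X) {g : Ω' → Ω} (hg : Measurable g) : MeasEntries fun ω => X (g ω) :=
  fun i j => (hX i j).comp hg

theorem MeasEntries.trace_re [Fintype m] {X : Ω → Matrix m m ℂ} (hX : MeasEntries X) :
    Measurable fun ω => (X ω).trace.re :=
  Complex.measurable_re.comp (Finset.measurable_sum _ fun i _ => hX i i)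

theorem MeasEntries.ketBra : MeasEntries fun α : m → ℂ => ketBra α := fun i j =>
  (measurable_pi_apply i).mul (Complex.continuous_conj.measurable.comp (measurable_pi_apply j))

variable [Fintype m] [DecidableEq m]

theorem MeasEntries.aeval {X : Ω → Matrix m m ℂ} (hX : MeasEntries X) (p : Polynomial ℝ) :
    MeasEntries fun ω => Polynomial.aeval (X ω) p := by
  induction p using Polynomial.induction_on' with
  | add p q hp hq => simp only [map_add]; exact hp.add hq
  | monomial k r =>
    have hk : MeasEntries fun ω => X ω ^ k := by
      induction k with
      | zero => simp only [pow_zero]; exact MeasEntries.const 1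
      | succ k ih => simp only [pow_succ]; exact ih.mul hX
    simp only [Polynomial.aeval_monomial]
    exact (MeasEntries.const _).mul hk

theorem conjDiag_apply (U : Matrix m m ℂ) (d : m → ℝ) (i j : m) :
    conjDiag U d i j = ∑ k, U i k * d k * star (U j k) := by
  rw [conjDiag, Matrix.mul_apply]
  exact Finset.sum_congr rfl fun k _ => by rw [Matrix.mul_diagonal, Matrix.conjTranspose_apply]

theorem tendsto_aeval_cfc {X : Matrix m m ℂ} (hX : X.IsHermitian) {f : ℝ → ℝ}
    {p : ℕ → Polynomial ℝ} (hp : ∀ x, Tendsto (fun k => (p k).eval x) atTop (𝓝 (f x))) (i j : m) :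
    Tendsto (fun k => Polynomial.aeval X (p k) i j) atTop (𝓝 (cfc f X i j)) := by
  obtain ⟨U, d, h1, h2, rfl⟩ := exists_conjDiag hX
  simp only [aeval_conjDiag h1, cfc_conjDiag h1, conjDiag_apply]
  refine tendsto_finsetSum _ fun k _ => ?_
  exact (((Complex.continuous_ofReal.tendsto _).comp (hp (d k))).const_mul _).mul_const _

/-- Borel functional calculus of a measurable family of Hermitian matrices, for functions of the
first Baire class. -/
theorem MeasEntries.cfc {X : Ω → Matrix m m ℂ} (hX : MeasEntries X) (hH : ∀ ω, (X ω).IsHermitian)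
    {f : ℝ → ℝ} {g : ℕ → ℝ → ℝ} (hg : ∀ k, Continuous (g k))
    (h : ∀ x, Tendsto (fun k => g k x) atTop (𝓝 (f x))) :
    MeasEntries fun ω => cfc f (X ω) := by
  obtain ⟨p, hp⟩ := exists_polynomial_tendsto hg h
  intro i j
  refine measurable_of_tendsto_metrizable (fun k => hX.aeval (p k) i j) ?_
  rw [tendsto_pi_nhds]
  exact fun ω => tendsto_aeval_cfc (hH ω) hp i j

theorem MeasEntries.suppProj {X : Ω → Matrix m m ℂ} (hX : MeasEntries X)
    (hH : ∀ ω, (X ω).IsHermitian) : MeasEntries fun ω => suppProj (X ω) := by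
  refine hX.cfc hH (g := fun k x => min 1 (k * |x|)) (fun k => by fun_prop) fun x => ?_
  by_cases hx : x = 0
  · simp [hx]
  · have hx' : 0 < |x| := abs_pos.mpr hx
    simp only [Set.mem_compl_iff, Set.mem_singleton_iff, hx, not_false_eq_true,
      Set.indicator_of_mem]
    refine tendsto_const_nhds.congr' ?_
    filter_upwards [(tendsto_natCast_atTop_atTop.atTop_mul_const hx').eventually_ge_atTop 1]
      with k hk
    exact (min_eq_left hk).symm

theorem MeasEntries.invSqrt {X : Ω → Matrix m m ℂ} (hX : MeasEntries X)
    (hH : ∀ ω, (X ω).IsHermitian) : MeasEntries fun ω => invSqrt (X ω) := by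
  -- The regularization keeps the denominator positive, and the factor √x makes the limit 0 for x ≤
  -- 0, in agreement with the convention `0⁻¹ = 0`.
  refine hX.cfc hH (g := fun k x => Real.sqrt x / (|x| + 1 / ((k : ℝ) + 1))) (fun k => ?_)
    fun x => ?_
  · refine Real.continuous_sqrt.div (by fun_prop) fun x => ?_
    have : 0 < |x| + 1 / ((k : ℝ) + 1) := by positivity
    exact this.ne'
  · rcases le_or_gt x 0 with hx | hx
    · simp [Real.sqrt_eq_zero_of_nonpos hx]
    have h1 : Tendsto (fun k : ℕ => |x| + 1 / ((k : ℝ) + 1)) atTop (𝓝 x) := by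
      simpa [abs_of_pos hx] using tendsto_one_div_add_atTop_nhds_zero_nat.const_add |x|
    have h2 := (tendsto_const_nhds (x := Real.sqrt x)).div h1 hx.ne'
    have h3 : Real.sqrt x / x = (Real.sqrt x)⁻¹ := Real.sqrt_div_self
    rwa [h3] at h2

theorem MeasEntries.entropy {X : Ω → Matrix m m ℂ} (hX : MeasEntries X)
    (hH : ∀ ω, (X ω).IsHermitian) : Measurable fun ω => entropy (X ω) :=
  (hX.cfc hH (g := fun _ x => Real.negMulLog x / Real.log 2)
    (fun _ => Real.continuous_negMulLog.div_const _) fun _ => tendsto_const_nhds).trace_re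

end Measurability

/-! ### Measurability of outputs, detectors and errors. -/

section OutputMeasurability

variable {κ a b : Type*} [Fintype κ] [DecidableEq κ] [Fintype a] [DecidableEq a]
  [Fintype b] [DecidableEq b] {A : κ → Matrix b a ℂ} {ρ : Matrix a a ℂ} {δ : ℝ} {n N : ℕ}

theorem measEntries_bobOut : MeasEntries fun α : (Fin n → a) → ℂ => bobOut A n α :=
  MeasEntries.sum _ fun _ _ => ((MeasEntries.const _).mul MeasEntries.ketBra).mul
    (MeasEntries.const _)

theorem measEntries_bobOutTyp : MeasEntries fun α : (Fin n → a) → ℂ => bobOutTyp A ρ δ n α :=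
  MeasEntries.sum _ fun _ _ => ((MeasEntries.const _).mul MeasEntries.ketBra).mul
    (MeasEntries.const _)

theorem measEntries_detector : MeasEntries fun α : (Fin n → a) → ℂ => detector A ρ δ n α := by
  have h := (measEntries_bobOutTyp (A := A) (ρ := ρ) (δ := δ) (n := n)).suppProj
    fun α => (bobOutTyp_posSemidef α).1
  exact (h.mul (MeasEntries.const _)).mul h

theorem measEntries_sqrtMeas (hA : IsChannel A) (hρ : IsState ρ) (i : Fin N) :
    MeasEntries fun c : Fin N → (Fin n → a) → ℂ => sqrtMeas A ρ δ n c i := by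
  have h : ∀ j : Fin N, MeasEntries fun c : Fin N → (Fin n → a) → ℂ => detector A ρ δ n (c j) :=
    fun j => measEntries_detector.comp (measurable_pi_apply j)
  have h2 := (MeasEntries.sum Finset.univ fun j _ => h j).invSqrt fun c =>
    (sum_posSemidef fun j => detector_posSemidef (δ := δ) hA hρ (c j)).1
  exact (h2.mul (h i)).mul h2

theorem measurable_errTyp (hA : IsChannel A) (hρ : IsState ρ) :
    Measurable fun c : Fin N → (Fin n → a) → ℂ => errTyp A ρ δ n c :=
  measurable_const.sub ((Finset.measurable_sum _ fun i _ =>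
    ((measEntries_bobOutTyp.comp (measurable_pi_apply i)).mul
      (measEntries_sqrtMeas hA hρ i)).trace_re).const_mul _)

theorem measurable_errActual (hA : IsChannel A) (hρ : IsState ρ) :
    Measurable fun c : Fin N → (Fin n → a) → ℂ => errActual A ρ δ n c :=
  measurable_const.sub ((Finset.measurable_sum _ fun i _ =>
    ((measEntries_bobOut.comp (measurable_pi_apply i)).mul
      (measEntries_sqrtMeas hA hρ i)).trace_re).const_mul _)

theorem measurable_chiB : Measurable fun c : Fin N → (Fin n → a) → ℂ => chiB A n c := by
  have h : ∀ i : Fin N, MeasEntries fun c : Fin N → (Fin n → a) → ℂ => bobOut A n (c i) :=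
    fun i => measEntries_bobOut.comp (measurable_pi_apply i)
  refine Measurable.sub ?_ (Finset.measurable_sum _ fun i _ =>
    ((h i).entropy fun c => (bobOut_posSemidef (c i)).1).const_mul _)
  refine (MeasEntries.sum Finset.univ fun i _ => (h i).smul _).entropy fun c => ?_
  exact (sum_posSemidef fun i => (bobOut_posSemidef (c i)).smul
    (Complex.zero_le_real.mpr (by positivity))).1

end OutputMeasurability

/-! ### Averages of linear functionals and of pairs of codewords. -/

section Averages

theorem AveragesTo.linear {m : Type*} [Fintype m] {μ : Measure (m → ℂ)}
    {τ : Matrix m m ℂ} (h : AveragesTo μ τ) (L : Matrix m m ℂ →ₗ[ℂ] ℂ) :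
    Integrable (fun α => L (ketBra α)) μ ∧ ∫ α, L (ketBra α) ∂μ = L τ := by
  classical
  have hL : ∀ X : Matrix m m ℂ, L X = ∑ i, ∑ j, X i j * L (Matrix.single i j 1) := by
    intro X
    conv_lhs => rw [Matrix.matrix_eq_sum_single X]
    simp only [map_sum]
    refine Finset.sum_congr rfl fun i _ => Finset.sum_congr rfl fun j _ => ?_
    rw [← smul_eq_mul, ← map_smul, Matrix.smul_single, smul_eq_mul, mul_one]
  have hi : ∀ i j, Integrable (fun α => ketBra α i j * L (Matrix.single i j 1)) μ :=
    fun i j => (h i j).1.mul_const _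
  refine ⟨(integrable_finsetSum _ fun i _ => integrable_finsetSum _ fun j _ => hi i j).congr
    (.of_forall fun α => (hL (ketBra α)).symm), ?_⟩
  rw [integral_congr_ae (.of_forall fun α => hL (ketBra α)), hL τ,
    integral_finsetSum _ fun i _ => integrable_finsetSum _ fun j _ => hi i j]
  refine Finset.sum_congr rfl fun i _ => ?_
  rw [integral_finsetSum _ fun j _ => hi i j]
  refine Finset.sum_congr rfl fun j _ => ?_
  rw [integral_mul_const, (h i j).2]

theorem AveragesTo.integrable_norm_sq {m : Type*} [Fintype m] {μ : Measure (m → ℂ)}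
    {τ : Matrix m m ℂ} (h : AveragesTo μ τ) : Integrable (fun α => ∑ x, ‖α x‖ ^ 2) μ := by
  refine integrable_finsetSum _ fun x _ => (h x x).1.norm.congr (.of_forall fun α => ?_)
  simp [ketBra, Matrix.vecMulVec_apply, sq]

theorem measurePreserving_pi_pair {Ω : Type*} [MeasurableSpace Ω] (μ : Measure Ω)
    [IsProbabilityMeasure μ] {N : ℕ} {i j : Fin N} (hij : i ≠ j) :
    MeasurePreserving (fun c : Fin N → Ω => (c i, c j)) (Measure.pi fun _ => μ) (μ.prod μ) := by
  refine ⟨by fun_prop, ?_⟩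
  have h := (ProbabilityTheory.iIndepFun_pi (μ := fun _ : Fin N => μ) (X := fun _ ω => ω)
    fun _ => aemeasurable_id).indepFun hij
  rw [ProbabilityTheory.indepFun_iff_map_prod_eq_prod_map_map
    (measurable_pi_apply i).aemeasurable (measurable_pi_apply j).aemeasurable] at h
  rw [h]
  exact congrArg₂ _ (measurePreserving_eval (fun _ : Fin N => μ) i).map_eq
    (measurePreserving_eval (fun _ : Fin N => μ) j).map_eq

end Averages

/-! ### Averages over random codes. -/

section RandomCodes

variable {κ a b : Type*} [Fintype κ] [DecidableEq κ] [Fintype a] [DecidableEq a]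
  [Fintype b] [DecidableEq b] {A : κ → Matrix b a ℂ} {ρ : Matrix a a ℂ} {δ : ℝ} {n N : ℕ}
  {μ : Measure ((Fin n → a) → ℂ)}

/-- The linear functional `X ↦ Tr (typMap X) Z`. -/
def typFunctional (A : κ → Matrix b a ℂ) (ρ : Matrix a a ℂ) (δ : ℝ) (n : ℕ)
    (Z : Matrix (Fin n → b) (Fin n → b) ℂ) : Matrix (Fin n → a) (Fin n → a) ℂ →ₗ[ℂ] ℂ where
  toFun X := (typMap A ρ δ n X * Z).trace
  map_add' X Y := by rw [typMap_add, Matrix.add_mul, Matrix.trace_add]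
  map_smul' z X := by rw [typMap_smul, Matrix.smul_mul, Matrix.trace_smul]; rfl

theorem integral_trace_bobOutTyp_mul {τ : Matrix (Fin n → a) (Fin n → a) ℂ}
    (h : AveragesTo μ τ) (Z : Matrix (Fin n → b) (Fin n → b) ℂ) :
    Integrable (fun α => (bobOutTyp A ρ δ n α * Z).trace.re) μ ∧
      ∫ α, (bobOutTyp A ρ δ n α * Z).trace.re ∂μ = (typMap A ρ δ n τ * Z).trace.re := by
  obtain ⟨h1, h2⟩ := h.linear (typFunctional A ρ δ n Z)
  refine ⟨h1.re, ?_⟩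
  have h3 := integral_re h1
  rw [h2] at h3
  exact h3

theorem typicalPart_trace_eq (hρ : IsState ρ) :
    (typicalPart ρ δ n).trace = ((typicalPart ρ δ n).trace.re : ℂ) :=
  Complex.ext rfl (Complex.le_def.mp (typicalPart_posSemidef hρ δ n).trace_nonneg).2.symm

theorem trace_typMap_typicalState (hρ : IsState ρ) (Z : Matrix (Fin n → b) (Fin n → b) ℂ) :
    (typMap A ρ δ n (typicalState ρ δ n) * Z).trace.re =
      (typicalPart ρ δ n).trace.re⁻¹ * (typMap A ρ δ n (typicalPart ρ δ n) * Z).trace.re := by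
  rw [typicalState, typMap_smul, Matrix.smul_mul, Matrix.trace_smul, typicalPart_trace_eq hρ,
    smul_eq_mul, ← Complex.ofReal_inv, Complex.re_ofReal_mul, Complex.ofReal_re]

variable [IsProbabilityMeasure μ]

/-- A detector is at most 1, so the overlap is dominated by the squared norm of the first vector,
which has finite mean. -/
theorem integrable_detector_overlap (hA : IsChannel A) (hρ : IsState ρ)
    {τ : Matrix (Fin n → a) (Fin n → a) ℂ} (h : AveragesTo μ τ) :
    Integrable (fun z : ((Fin n → a) → ℂ) × ((Fin n → a) → ℂ) =>
      (bobOutTyp A ρ δ n z.1 * detector A ρ δ n z.2).trace.re) (μ.prod μ) := by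
  refine (h.integrable_norm_sq.comp_fst μ).mono'
    ((measEntries_bobOutTyp.comp measurable_fst).mul
      (measEntries_detector.comp measurable_snd)).trace_re.aestronglyMeasurable
    (.of_forall fun z => ?_)
  rw [Real.norm_of_nonneg
    (trace_mul_re_nonneg (bobOutTyp_posSemidef _) (detector_posSemidef hA hρ _))]
  have h1 := trace_mul_re_nonneg (bobOutTyp_posSemidef (A := A) (ρ := ρ) (δ := δ) z.1)
    (one_sub_posSemidef_of_idem (detector_isHermitian (δ := δ) hA hρ z.2)
      (detector_mul_self hA hρ z.2))
  rw [Matrix.mul_sub, Matrix.mul_one, Matrix.trace_sub, Complex.sub_re] at h1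
  have h2 := trace_typMap_le (δ := δ) hA hρ (ketBra_posSemidef z.1)
  rw [trace_ketBra, Complex.ofReal_re, ← bobOutTyp_eq] at h2
  linarith

/-- The average overlap of the projected output of one codeword with the detector of another. -/
theorem integral_detector_overlap_le (hA : IsChannel A) (hρ : IsState ρ)
    (h : AveragesTo μ (typicalState ρ δ n)) :
    ∫ z, (bobOutTyp A ρ δ n z.1 * detector A ρ δ n z.2).trace.re ∂(μ.prod μ) ≤
      (typicalPart ρ δ n).trace.re⁻¹ * (2 : ℝ) ^ (-((n : ℝ) *
        (coherentInfo A ρ - 2 * δ))) := by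
  -- The average over the transmitted codeword is taken first, with the detector fixed. The overlap
  -- is linear in |α⟩⟨α|, so the average replaces it by the typical state; the detector depends on β
  -- nonlinearly, but its trace has a uniform bound.
  rw [integral_prod_symm _ (integrable_detector_overlap hA hρ h)]
  have ht : 0 ≤ (typicalPart ρ δ n).trace.re⁻¹ :=
    inv_nonneg.mpr (trace_re_nonneg (typicalPart_posSemidef hρ δ n))
  have hb : ∀ β : (Fin n → a) → ℂ,
      ∫ α, (bobOutTyp A ρ δ n α * detector A ρ δ n β).trace.re ∂μ ≤
        (typicalPart ρ δ n).trace.re⁻¹ * (2 : ℝ) ^ (-((n : ℝ) *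
          (coherentInfo A ρ - 2 * δ))) := by
    intro β
    rw [(integral_trace_bobOutTyp_mul h _).2, trace_typMap_typicalState hρ]
    refine mul_le_mul_of_nonneg_left ?_ ht
    refine (trace_typMap_typicalPart_mul_le hA hρ (detector_posSemidef hA hρ β)).trans ?_
    refine (mul_le_mul_of_nonneg_left (trace_detector_le hA hρ β) (by positivity)).trans
      (le_of_eq ?_)
    rw [← Real.rpow_add two_pos, coherentInfo]
    congr 1; ring
  refine (integral_mono_of_nonneg (.of_forall fun β => integral_nonneg fun α =>
    trace_mul_re_nonneg (bobOutTyp_posSemidef _) (detector_posSemidef hA hρ _))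
    (integrable_const _) (.of_forall hb)).trans ?_
  simp

theorem integrable_total_norm_sq {τ : Matrix (Fin n → a) (Fin n → a) ℂ} (h : AveragesTo μ τ) :
    Integrable (fun c : Fin N → (Fin n → a) → ℂ => (1 / (N : ℝ)) * ∑ i, ∑ x, ‖c i x‖ ^ 2)
      (Measure.pi fun _ => μ) :=
  (integrable_finsetSum _ fun i _ => integrable_comp_eval (i := i)
    (μ := fun _ : Fin N => μ) h.integrable_norm_sq).const_mul _

theorem integrable_errTyp (hA : IsChannel A) (hρ : IsState ρ)
    {τ : Matrix (Fin n → a) (Fin n → a) ℂ} (h : AveragesTo μ τ) :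
    Integrable (fun c : Fin N → (Fin n → a) → ℂ => errTyp A ρ δ n c) (Measure.pi fun _ => μ) := by
  refine ((integrable_const 1).add (integrable_total_norm_sq h)).mono'
    (measurable_errTyp hA hρ).aestronglyMeasurable (.of_forall fun c => ?_)
  have h1 := errActual_ge (δ := δ) hA hρ c
  have h2 := errActual_le_errTyp (δ := δ) hA hρ c
  have h3 := errTyp_le_one (δ := δ) hA hρ c
  have h4 : 0 ≤ (1 / (N : ℝ)) * ∑ i, ∑ x, ‖c i x‖ ^ 2 := by positivity
  simp only [Pi.add_apply]
  exact abs_le.mpr ⟨by linarith, by linarith⟩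

theorem integrable_errActual (hA : IsChannel A) (hρ : IsState ρ)
    {τ : Matrix (Fin n → a) (Fin n → a) ℂ} (h : AveragesTo μ τ) :
    Integrable (fun c : Fin N → (Fin n → a) → ℂ => errActual A ρ δ n c)
      (Measure.pi fun _ => μ) := by
  refine ((integrable_const 1).add (integrable_total_norm_sq h)).mono'
    (measurable_errActual hA hρ).aestronglyMeasurable (.of_forall fun c => ?_)
  have h1 := errActual_ge (δ := δ) hA hρ c
  have h2 := errActual_le_errTyp (δ := δ) hA hρ c
  have h3 := errTyp_le_one (δ := δ) hA hρ c
  have h4 : 0 ≤ (1 / (N : ℝ)) * ∑ i, ∑ x, ‖c i x‖ ^ 2 := by positivity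
  simp only [Pi.add_apply]
  exact abs_le.mpr ⟨by linarith, by linarith⟩

/-- The average error of the square-root measurement in terms of the typical weights. -/
theorem integral_errTyp_le (hA : IsChannel A) (hρ : IsState ρ) (hN : 0 < N)
    (h : AveragesTo μ (typicalState ρ δ n)) :
    ∫ c : Fin N → (Fin n → a) → ℂ, errTyp A ρ δ n c ∂(Measure.pi fun _ => μ) ≤
      1 - (typicalPart ρ δ n).trace.re⁻¹ * (typMap A ρ δ n (typicalPart ρ δ n)).trace.re +
        N * ((typicalPart ρ δ n).trace.re⁻¹ *
          (2 : ℝ) ^ (-((n : ℝ) * (coherentInfo A ρ - 2 * δ)))) := by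
  set K := (typicalPart ρ δ n).trace.re⁻¹ *
    (2 : ℝ) ^ (-((n : ℝ) * (coherentInfo A ρ - 2 * δ)))
  set w := (typicalPart ρ δ n).trace.re⁻¹ * (typMap A ρ δ n (typicalPart ρ δ n)).trace.re
  have hN' : (0 : ℝ) < N := by exact_mod_cast hN
  have hK : 0 ≤ K := mul_nonneg
    (inv_nonneg.mpr (trace_re_nonneg (typicalPart_posSemidef hρ δ n))) (by positivity)
  have htr := integral_trace_bobOutTyp_mul (A := A) (ρ := ρ) (δ := δ) h 1
  have hw := trace_typMap_typicalState (A := A) (δ := δ) (n := n) hρ 1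
  simp only [Matrix.mul_one] at htr hw
  have hi1 : ∀ i : Fin N, Integrable (fun c : Fin N → (Fin n → a) → ℂ =>
      (bobOutTyp A ρ δ n (c i)).trace.re) (Measure.pi fun _ => μ) := fun i =>
    integrable_comp_eval (i := i) (μ := fun _ : Fin N => μ) htr.1
  have he1 : ∀ i : Fin N, ∫ c : Fin N → (Fin n → a) → ℂ,
      (bobOutTyp A ρ δ n (c i)).trace.re ∂(Measure.pi fun _ => μ) = w := by
    intro i
    rw [integral_comp_eval (i := i) (μ := fun _ : Fin N => μ) htr.1.aestronglyMeasurable, htr.2, hw]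
  have hpair := integrable_detector_overlap (δ := δ) hA hρ h
  have hi2 : ∀ i : Fin N, ∀ j ∈ Finset.univ.erase i,
      Integrable (fun c : Fin N → (Fin n → a) → ℂ =>
        (bobOutTyp A ρ δ n (c i) * detector A ρ δ n (c j)).trace.re) (Measure.pi fun _ => μ) := by
    intro i j hj
    have hmp := measurePreserving_pi_pair μ (Finset.ne_of_mem_erase hj).symm
    exact hmp.integrable_comp_of_integrable hpair
  have he2 : ∀ i : Fin N, ∀ j ∈ Finset.univ.erase i, ∫ c : Fin N → (Fin n → a) → ℂ,
      (bobOutTyp A ρ δ n (c i) * detector A ρ δ n (c j)).trace.re ∂(Measure.pi fun _ => μ) ≤ K := by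
    intro i j hj
    have hmp := measurePreserving_pi_pair μ (Finset.ne_of_mem_erase hj).symm
    refine le_trans (le_of_eq ?_) (integral_detector_overlap_le hA hρ h)
    rw [← hmp.map_eq, integral_map hmp.aemeasurable (hmp.map_eq ▸ hpair.aestronglyMeasurable)]
  have hI1 : Integrable (fun c : Fin N → (Fin n → a) → ℂ =>
      (1 / (N : ℝ)) * ∑ i, (bobOutTyp A ρ δ n (c i)).trace.re) (Measure.pi fun _ => μ) :=
    (integrable_finsetSum _ fun i _ => hi1 i).const_mul _
  have hI2 : Integrable (fun c : Fin N → (Fin n → a) → ℂ =>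
      (1 / (N : ℝ)) * ∑ i, ∑ j ∈ Finset.univ.erase i,
        (bobOutTyp A ρ δ n (c i) * detector A ρ δ n (c j)).trace.re) (Measure.pi fun _ => μ) :=
    (integrable_finsetSum _ fun i _ => integrable_finsetSum _ fun j hj => hi2 i j hj).const_mul _
  refine (integral_mono (integrable_errTyp hA hρ h) (((integrable_const 1).sub hI1).add hI2)
    fun c => errTyp_le hA hρ c).trans ?_
  rw [integral_add' ((integrable_const 1).sub hI1) hI2, integral_sub' (integrable_const 1) hI1,
    integral_const_mul, integral_const_mul, integral_finsetSum _ fun i _ => hi1 i,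
    integral_finsetSum _ fun i _ => integrable_finsetSum _ fun j hj => hi2 i j hj,
    Finset.sum_congr rfl fun i _ => he1 i]
  -- The N - 1 competitors of each codeword are counted as N.
  have hsum : ∑ i : Fin N, ∫ c : Fin N → (Fin n → a) → ℂ, ∑ j ∈ Finset.univ.erase i,
      (bobOutTyp A ρ δ n (c i) * detector A ρ δ n (c j)).trace.re ∂(Measure.pi fun _ => μ) ≤
        N * (N * K) := by
    refine (Finset.sum_le_card_nsmul _ _ (N * K) fun i _ => ?_).trans (le_of_eq (by simp))
    rw [integral_finsetSum _ fun j hj => hi2 i j hj]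
    refine (Finset.sum_le_card_nsmul _ _ K fun j hj => he2 i j hj).trans ?_
    rw [nsmul_eq_mul]
    refine mul_le_mul_of_nonneg_right ?_ hK
    exact_mod_cast (Finset.card_le_univ _).trans (le_of_eq (by simp))
  have hsum' := mul_le_mul_of_nonneg_left hsum (show 0 ≤ 1 / (N : ℝ) by positivity)
  have e1 : 1 / (N : ℝ) * (N * (N * K)) = N * K := by field_simp
  have e2 : 1 / (N : ℝ) * ∑ _i : Fin N, w = w := by
    simp; field_simp
  rw [e2]
  rw [e1] at hsum'
  simp only [integral_const, probReal_univ, smul_eq_mul, mul_one]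
  linarith

end RandomCodes

/-! ### Exponential bounds for the errors and for the Holevo quantity. -/

section ErrorBounds

variable {κ a b : Type*} [Fintype κ] [DecidableEq κ] [Fintype a] [DecidableEq a]
  [Fintype b] [DecidableEq b] {A : κ → Matrix b a ℂ} {ρ : Matrix a a ℂ} {δ R : ℝ}

theorem exp_neg_mul_le {c c' : ℝ} (h : c ≤ c') (n : ℕ) :
    Real.exp (-c' * n) ≤ Real.exp (-c * n) := by
  apply Real.exp_le_exp.mpr
  have := mul_le_mul_of_nonneg_right h (Nat.cast_nonneg (α := ℝ) n)
  linarith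

theorem typicalPart_trace_le_one (hρ : IsState ρ) (n : ℕ) :
    (typicalPart ρ δ n).trace.re ≤ 1 := by
  have h := trace_re_nonneg (tensorPow_sub_typicalPart_posSemidef hρ δ n)
  rw [Matrix.trace_sub, Complex.sub_re, tensorPow_trace, hρ.2, one_pow, Complex.one_re] at h
  linarith

theorem exists_integral_errTyp_bound (hA : IsChannel A) (hρ : IsState ρ)
    (hE : ∀ k l, k ≠ l → Matrix.trace (A k * ρ * (A l)ᴴ) = 0) (hδ : 0 < δ)
    (hδR : 2 * δ < coherentInfo A ρ - R) :
    ∃ c : ℝ, 0 < c ∧ c ≤ 1 ∧ ∀ n N : ℕ, 0 < N → (N : ℝ) ≤ (2 : ℝ) ^ ((n : ℝ) * R) →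
      ∀ μ : Measure ((Fin n → a) → ℂ), IsProbabilityMeasure μ →
        AveragesTo μ (typicalState ρ δ n) →
        ∫ c : Fin N → (Fin n → a) → ℂ, errTyp A ρ δ n c ∂(Measure.pi fun _ => μ) ≤
          8 * Real.exp (-c * n) := by
  obtain ⟨cA, hcA, hA'⟩ := exists_typicalPart_trace_bound hρ hδ
  obtain ⟨cB, hcB, hB'⟩ := exists_typicalPart_trace_bound (isState_krausMap hA hρ) hδ
  obtain ⟨cE, hcE, hE'⟩ := exists_atypicalEnv_bound hA hρ hE hδ
  set g := (coherentInfo A ρ - R - 2 * δ) * Real.log 2 with hg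
  have hg0 : 0 < g := mul_pos (by linarith) (Real.log_pos one_lt_two)
  -- Besides the three concentration rates and the gap g, the rate is capped at 1 so that it can
  -- later also absorb exp(-n).
  refine ⟨min 1 (min (min cA cB) (min cE g)),
    lt_min one_pos (lt_min (lt_min hcA hcB) (lt_min hcE hg0)), min_le_left _ _, ?_⟩
  intro n N hN hNR μ hμ hav
  set c := min 1 (min (min cA cB) (min cE g))
  have hle : c ≤ min (min cA cB) (min cE g) := min_le_right _ _
  have eA := exp_neg_mul_le (hle.trans ((min_le_left _ _).trans (min_le_left _ _))) n
  have eB := exp_neg_mul_le (hle.trans ((min_le_left _ _).trans (min_le_right _ _))) n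
  have eE := exp_neg_mul_le (hle.trans ((min_le_right _ _).trans (min_le_left _ _))) n
  have eG := exp_neg_mul_le (hle.trans ((min_le_right _ _).trans (min_le_right _ _))) n
  have hAn := hA' n
  have hBn := hB' n
  have hEn := hE' n
  set t := (typicalPart ρ δ n).trace.re with ht
  have ht1 : t ≤ 1 := typicalPart_trace_le_one hρ n
  -- If the typical weight is below 1/2, then 1/2 < 2 exp(-cn) and the trivial bound 1 suffices;
  -- this also covers t = 0, where the normalized state is the zero matrix. Otherwise 1/t ≤ 2, and
  -- the constant is 8 = 2 + 2 + 2 for the three losses plus 2 for the overlaps.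
  rcases lt_or_ge t (1 / 2) with hlt | hge
  · have h1 : ∫ c : Fin N → (Fin n → a) → ℂ, errTyp A ρ δ n c ∂(Measure.pi fun _ => μ) ≤ 1 := by
      refine (integral_mono (integrable_errTyp hA hρ hav) (integrable_const 1)
        fun c => errTyp_le_one hA hρ c).trans ?_
      simp
    linarith
  have ht0 : 0 < t := by linarith
  have hti : 1 ≤ t⁻¹ := (one_le_inv₀ ht0).mpr ht1
  have hti2 : t⁻¹ ≤ 2 := by
    rw [inv_le_comm₀ ht0 two_pos]; linarith
  have hmain := integral_errTyp_le hA hρ hN hav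
  rw [← ht] at hmain
  have hX : 0 ≤ (typMap A ρ δ n (typicalPart ρ δ n)).trace.re :=
    trace_re_nonneg (typMap_posSemidef (typicalPart_posSemidef hρ δ n))
  have hX1 := le_mul_of_one_le_left hX hti
  have hX2 := trace_typMap_typicalPart_ge (δ := δ) (n := n) hA hρ
  rw [← ht] at hX2
  have hexp : (N : ℝ) * (2 : ℝ) ^ (-((n : ℝ) * (coherentInfo A ρ - 2 * δ))) ≤
      Real.exp (-g * n) := by
    refine (mul_le_mul_of_nonneg_right hNR (by positivity)).trans (le_of_eq ?_)
    rw [← Real.rpow_add two_pos, Real.rpow_def_of_pos two_pos, hg]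
    congr 1; ring
  have hlast : (N : ℝ) * (t⁻¹ * (2 : ℝ) ^ (-((n : ℝ) * (coherentInfo A ρ - 2 * δ)))) ≤
      2 * Real.exp (-g * n) := by
    calc _ = t⁻¹ * ((N : ℝ) * (2 : ℝ) ^ (-((n : ℝ) * (coherentInfo A ρ - 2 * δ)))) := by ring
      _ ≤ 2 * Real.exp (-g * n) := mul_le_mul hti2 hexp (by positivity) two_pos.le
  linarith

theorem isState_bobOut {n : ℕ} (hA : IsChannel A) {α : (Fin n → a) → ℂ}
    (hα : ∑ i, ‖α i‖ ^ 2 = 1) : IsState (bobOut A n α) :=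
  ⟨bobOut_posSemidef α, by rw [trace_bobOut hA, hα, Complex.ofReal_one]⟩

theorem natCast_mul_exp_le {c : ℝ} (hc : 0 < c) (n : ℕ) :
    (n : ℝ) * Real.exp (-c * n) ≤ 2 / c * Real.exp (-(c / 2) * n) := by
  have h1 : c / 2 * n ≤ Real.exp (c / 2 * n) := by
    have := Real.add_one_le_exp (c / 2 * n); linarith
  have h2 : (n : ℝ) ≤ 2 / c * Real.exp (c / 2 * n) := by
    have := mul_le_mul_of_nonneg_left h1 (show 0 ≤ 2 / c by positivity)
    calc (n : ℝ) = 2 / c * (c / 2 * n) := by field_simp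
      _ ≤ _ := this
  calc (n : ℝ) * Real.exp (-c * n) ≤ 2 / c * Real.exp (c / 2 * n) * Real.exp (-c * n) :=
        mul_le_mul_of_nonneg_right h2 (Real.exp_pos _).le
    _ = _ := by rw [mul_assoc, ← Real.exp_add]; ring_nf

/-- For unit codewords the Holevo quantity differs from `log₂ N` by at most a multiple of the
average error. -/
theorem chiB_bounds (hA : IsChannel A) (hρ : IsState ρ) {n N : ℕ} (hN : 0 < N)
    {c : Fin N → (Fin n → a) → ℂ} (hc : ∀ i, ∑ x, ‖c i x‖ ^ 2 = 1) :
    0 ≤ Real.logb 2 N - chiB A n c ∧ Real.logb 2 N - chiB A n c ≤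
      (Real.log 2)⁻¹ * (errActual A ρ δ n c * (Real.log N + n) + Real.exp (-n)) := by
  have hlog : 0 < Real.log 2 := Real.log_pos one_lt_two
  have hN' : (0 : ℝ) < N := by exact_mod_cast hN
  -- T = N eⁿ makes N/T exponentially small while log T = log N + n stays linear in n.
  obtain ⟨h1, h2⟩ := holevo_uniform_bounds hN (fun i => isState_bobOut hA (hc i))
    (fun i => sqrtMeas_posSemidef (δ := δ) hA hρ c i) (one_sub_sum_sqrtMeas_posSemidef hA hρ c)
    (T := N * Real.exp n) (by positivity)
  refine ⟨h1, ?_⟩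
  have h3 : (N : ℝ) / (N * Real.exp n) = Real.exp (-n) := by
    rw [Real.exp_neg]; field_simp
  rw [h3, Real.log_mul hN'.ne' (Real.exp_pos _).ne', Real.log_exp] at h2
  rw [inv_mul_eq_div, le_div_iff₀ hlog]
  exact h2

theorem integral_chiB_bound (hA : IsChannel A) (hρ : IsState ρ) {n N : ℕ} (hN : 0 < N)
    {μ : Measure ((Fin n → a) → ℂ)} [IsProbabilityMeasure μ]
    {τ : Matrix (Fin n → a) (Fin n → a) ℂ} (h : AveragesTo μ τ)
    (hunit : ∀ᵐ α ∂μ, ∑ i, ‖α i‖ ^ 2 = 1) :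
    Integrable (fun c : Fin N → (Fin n → a) → ℂ => chiB A n c) (Measure.pi fun _ => μ) ∧
      ∫ c : Fin N → (Fin n → a) → ℂ, |Real.logb 2 N - chiB A n c| ∂(Measure.pi fun _ => μ) ≤
        (Real.log 2)⁻¹ * ((∫ c : Fin N → (Fin n → a) → ℂ, errActual A ρ δ n c
          ∂(Measure.pi fun _ => μ)) * (Real.log N + n) + Real.exp (-n)) := by
  have hae : ∀ᵐ c : Fin N → (Fin n → a) → ℂ ∂(Measure.pi fun _ => μ),
      ∀ i, ∑ x, ‖c i x‖ ^ 2 = 1 :=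
    ae_all_iff.mpr fun i =>
      (measurePreserving_eval (fun _ : Fin N => μ) i).quasiMeasurePreserving.ae hunit
  have hI := integrable_errActual (N := N) (δ := δ) hA hρ h
  have hbound : Integrable (fun c : Fin N → (Fin n → a) → ℂ =>
      (Real.log 2)⁻¹ * (errActual A ρ δ n c * (Real.log N + n) + Real.exp (-n)))
      (Measure.pi fun _ => μ) :=
    ((hI.mul_const _).add (integrable_const _)).const_mul _
  have hdiff : ∀ᵐ c : Fin N → (Fin n → a) → ℂ ∂(Measure.pi fun _ => μ),
      |Real.logb 2 N - chiB A n c| ≤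
        (Real.log 2)⁻¹ * (errActual A ρ δ n c * (Real.log N + n) + Real.exp (-n)) := by
    filter_upwards [hae] with c hc
    obtain ⟨h1, h2⟩ := chiB_bounds (δ := δ) hA hρ hN hc
    rwa [abs_of_nonneg h1]
  have hsub : Integrable (fun c : Fin N → (Fin n → a) → ℂ => Real.logb 2 N - chiB A n c)
      (Measure.pi fun _ => μ) :=
    hbound.mono' (measurable_const.sub measurable_chiB).aestronglyMeasurable hdiff
  refine ⟨?_, ?_⟩
  · have := (integrable_const (Real.logb 2 N)).sub hsub
    exact this.congr (.of_forall fun c => by simp)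
  · refine (integral_mono_ae hsub.abs hbound hdiff).trans (le_of_eq ?_)
    rw [integral_const_mul, integral_add (hI.mul_const _) (integrable_const _),
      integral_mul_const]
    simp

end ErrorBounds

end QCoding

end

/-! ### Assembly of the three estimates. -/

theorem mainTheorem2 {κ a b : Type*} [Fintype κ] [DecidableEq κ] [Fintype a] [DecidableEq a]
    [Fintype b] [DecidableEq b]
    (A : κ → Matrix b a ℂ) (hA : QCoding.IsChannel A)
    (ρ : Matrix a a ℂ) (hρ : QCoding.IsState ρ)
    -- the Kraus operators are chosen such that the environment state is diagonal
    (hE : ∀ k l, k ≠ l → Matrix.trace (A k * ρ * (A l)ᴴ) = 0)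
    (R : ℝ) (hR : R < QCoding.coherentInfo A ρ)
    (δ : ℝ) (hδ : 0 < δ) (hδR : 2 * δ < QCoding.coherentInfo A ρ - R) :
    -- the square-root measurement of every code is a (sub-normalized) POVM
    (∀ (n N : ℕ) (c : Fin N → (Fin n → a) → ℂ),
      (∀ i, (QCoding.sqrtMeas A ρ δ n c i).PosSemidef) ∧
        (1 - ∑ i, QCoding.sqrtMeas A ρ δ n c i).PosSemidef) ∧
    ∃ C c₀ : ℝ, 0 < c₀ ∧
      ∀ (n N : ℕ), 0 < N → (N : ℝ) ≤ (2 : ℝ) ^ ((n : ℝ) * R) →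
      ∀ μ : Measure ((Fin n → a) → ℂ), IsProbabilityMeasure μ →
        QCoding.AveragesTo μ (QCoding.typicalState ρ δ n) →
        -- averages over codes of `N` independent codewords
        (Integrable (fun c : Fin N → (Fin n → a) → ℂ => QCoding.errTyp A ρ δ n c)
            (Measure.pi fun _ => μ) ∧
          ∫ c : Fin N → (Fin n → a) → ℂ, QCoding.errTyp A ρ δ n c ∂(Measure.pi fun _ => μ)
            ≤ C * Real.exp (-c₀ * n)) ∧
        (Integrable (fun c : Fin N → (Fin n → a) → ℂ => QCoding.errActual A ρ δ n c)
            (Measure.pi fun _ => μ) ∧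
          ∫ c : Fin N → (Fin n → a) → ℂ, QCoding.errActual A ρ δ n c ∂(Measure.pi fun _ => μ)
            ≤ C * Real.exp (-c₀ * n)) ∧
        -- for ensembles of unit vectors, `χ_B` is close to `log N`
        ((∀ᵐ α ∂μ, ∑ i, ‖α i‖ ^ 2 = 1) →
          Integrable (fun c : Fin N → (Fin n → a) → ℂ => QCoding.chiB A n c)
            (Measure.pi fun _ => μ) ∧
          ∫ c : Fin N → (Fin n → a) → ℂ, |Real.logb 2 N - QCoding.chiB A n c|
              ∂(Measure.pi fun _ => μ) ≤ C * Real.exp (-c₀ * n)) := by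
  refine ⟨fun n N c => ⟨fun i => QCoding.sqrtMeas_posSemidef hA hρ c i,
    QCoding.one_sub_sum_sqrtMeas_posSemidef hA hρ c⟩, ?_⟩
  obtain ⟨c, hc, hc1, hbound⟩ := QCoding.exists_integral_errTyp_bound hA hρ hE hδ hδR
  have hlog : 0 < Real.log 2 := Real.log_pos one_lt_two
  have hlog1 : Real.log 2 ≤ 1 := by
    have := Real.log_le_sub_one_of_pos (two_pos (α := ℝ)); linarith
  set C' := (Real.log 2)⁻¹ * (8 * (|R| + 1) * (2 / c) + 1) with hC'
  have hC'0 : 0 ≤ C' := by positivity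
  -- The Holevo bound multiplies the error 8 exp(-cn) by at most (|R| + 1) n; half of the rate c
  -- absorbs this n at the price 2/c.
  refine ⟨8 + C', c / 2, by positivity, ?_⟩
  intro n N hN hNR μ hμ hav
  have hn : (0 : ℝ) ≤ n := Nat.cast_nonneg n
  have hN1 : (1 : ℝ) ≤ N := by exact_mod_cast hN
  have hT := QCoding.integrable_errTyp (N := N) (δ := δ) hA hρ hav
  have hAc := QCoding.integrable_errActual (N := N) (δ := δ) hA hρ hav
  have hT8 := hbound n N hN hNR μ hμ hav
  have hA8 := (integral_mono hAc hT fun c => QCoding.errActual_le_errTyp hA hρ c).trans hT8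
  have hexp : Real.exp (-c * n) ≤ Real.exp (-(c / 2) * n) :=
    QCoding.exp_neg_mul_le (by linarith) n
  have hC'e : 0 ≤ C' * Real.exp (-(c / 2) * n) := by positivity
  refine ⟨⟨hT, by linarith⟩, ⟨hAc, by linarith⟩, fun hunit => ?_⟩
  obtain ⟨h1, h2⟩ := QCoding.integral_chiB_bound (δ := δ) hA hρ hN hav hunit
  refine ⟨h1, h2.trans ?_⟩
  have hlogN : Real.log N + n ≤ (|R| + 1) * n := by
    have h3 := Real.log_le_log (by linarith) hNR
    rw [Real.log_rpow two_pos] at h3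
    have h4 : (n : ℝ) * R * Real.log 2 ≤ n * |R| * 1 :=
      (mul_le_mul_of_nonneg_right (mul_le_mul_of_nonneg_left (le_abs_self R) hn) hlog.le).trans
        (mul_le_mul_of_nonneg_left hlog1 (by positivity))
    linarith
  have hlogN0 : 0 ≤ Real.log N + n := add_nonneg (Real.log_nonneg hN1) hn
  have h5 : (∫ c : Fin N → (Fin n → a) → ℂ, QCoding.errActual A ρ δ n c
      ∂(Measure.pi fun _ => μ)) * (Real.log N + n) ≤
      8 * (|R| + 1) * (2 / c) * Real.exp (-(c / 2) * n) := by
    calc _ ≤ 8 * Real.exp (-c * n) * (Real.log N + n) := mul_le_mul_of_nonneg_right hA8 hlogN0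
      _ ≤ 8 * Real.exp (-c * n) * ((|R| + 1) * n) :=
          mul_le_mul_of_nonneg_left hlogN (by positivity)
      _ = 8 * (|R| + 1) * (n * Real.exp (-c * n)) := by ring
      _ ≤ 8 * (|R| + 1) * (2 / c * Real.exp (-(c / 2) * n)) :=
          mul_le_mul_of_nonneg_left (QCoding.natCast_mul_exp_le hc n) (by positivity)
      _ = _ := by ring
  have h6 : Real.exp (-n) ≤ Real.exp (-(c / 2) * n) := by
    have := QCoding.exp_neg_mul_le (show c / 2 ≤ 1 by linarith) n
    simpa using this
  have h7 := mul_le_mul_of_nonneg_left (add_le_add h5 h6) (inv_nonneg.mpr hlog.le)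
  refine h7.trans ?_
  have h8 : (Real.log 2)⁻¹ * (8 * (|R| + 1) * (2 / c) * Real.exp (-(c / 2) * n) +
      Real.exp (-(c / 2) * n)) = C' * Real.exp (-(c / 2) * n) := by rw [hC']; ring
  rw [h8]
  have h9 := Real.exp_pos (-(c / 2) * n)
  linarith
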